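/- For an open set $V\subset\mathbb R^2$ let $W^{k,2}(V)$ be the space of functions in $L^2(V)$ whose weak partial derivatives up to order $k$ exist and lie in $L^2(V)$, and let $C^k_0(V)$ be the space of $C^k$ functions with compact support in $V$. Subscripts denote (weak) partial derivatives. Let $\Omega\subset\mathbb R^2$ be open and let $v\in W^{2,2}(\Omega)$ be a weak solution of $$\Delta^2 v+\operatorname{div}\big((1-|Dv|^2)Dv\big)=0\quad\text{in }\Omega,$$ i.e. $\int_\Omega \Delta v\,\Delta\phi-(1-|Dv|^2)Dv\cdot D\phi\,dz=0$ for all $\phi\in C_0^\infty(\Omega)$. Then for every open $U\subset\subset\Omega$ (that is, $\overline U$ is compact and $\overline U\subset\Omega$): 1. $v\in W^{3,2}(U)$, and $(1-|Dv|^2)Dv\in W^{1,2}(U;\mathbb R^2)$; 2. for every $\phi\in C^1_0(U)\cap W^{3,2}(U)$ (in particular for every $\phi\in C^3_0(U)$) the following integrand is integrable and $$\int_U\ \sum_{i,j,p=1}^2 v_{ijp}\,\phi_{ijp}-\sum_{p=1}^2\big((1-|Dv|^2)Dv\big)_p\cdot D\phi_p\,dz=0 .$$ -/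

import Mathlib

open MeasureTheory
open scoped ContDiff

noncomputable section

/-- The Euclidean plane `ℝ²`. -/
abbrev Plane : Type := EuclideanSpace ℝ (Fin 2)

/-- The classical partial derivative `∂φ/∂x_i`. -/
def partialDeriv (i : Fin 2) (φ : Plane → ℝ) (x : Plane) : ℝ :=
  fderiv ℝ φ x (EuclideanSpace.single i 1)

/-- `φ ∈ C_0^n(Ω)`: `φ` is of class `C^n` with compact support contained in `Ω`. -/
def IsTestFunction (n : ℕ∞) (Ω : Set Plane) (φ : Plane → ℝ) : Prop :=
  ContDiff ℝ n φ ∧ HasCompactSupport φ ∧ tsupport φ ⊆ Ω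

/-- `g` is a weak partial derivative of `f` in the direction `x_i` on the open set `Ω`. -/
def HasWeakPartialDeriv (Ω : Set Plane) (i : Fin 2) (f g : Plane → ℝ) : Prop :=
  LocallyIntegrableOn f Ω ∧ LocallyIntegrableOn g Ω ∧
    ∀ φ : Plane → ℝ, IsTestFunction ⊤ Ω φ →
      ∫ x in Ω, f x * partialDeriv i φ x = - ∫ x in Ω, g x * φ x

/-- `f ∈ W^{k,2}(Ω)`: `f` and all its weak partial derivatives of order at most `k` exist and are
square integrable on `Ω`. -/
def MemW2 : ℕ → Set Plane → (Plane → ℝ) → Prop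
  | 0, Ω, f => MemLp f 2 (volume.restrict Ω)
  | k + 1, Ω, f => MemLp f 2 (volume.restrict Ω) ∧
      ∀ i : Fin 2, ∃ g : Plane → ℝ, HasWeakPartialDeriv Ω i f g ∧ MemW2 k Ω g

open Classical in
/-- A representative of the weak partial derivative `f_i` on `Ω` (unique almost everywhere on the
open set `Ω`; the value is `0` if there is no weak derivative). -/
def weakDeriv (Ω : Set Plane) (i : Fin 2) (f : Plane → ℝ) : Plane → ℝ :=
  if h : ∃ g : Plane → ℝ, HasWeakPartialDeriv Ω i f g then h.choose else 0

/-- The `k`-th component of the vector field `(1 - |Dv|²) Dv`, with the weak gradient `Dv`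
on `Ω`. -/
def flux (Ω : Set Plane) (v : Plane → ℝ) (k : Fin 2) (x : Plane) : ℝ :=
  (1 - ∑ i : Fin 2, (weakDeriv Ω i v x) ^ 2) * weakDeriv Ω k v x

/-- `v ∈ W^{2,2}(Ω)` satisfies `Δ²v + div((1 - |Dv|²) Dv) = 0` weakly in `Ω`:
`∫ Δv Δφ - (1 - |Dv|²) Dv · Dφ = 0` for all `φ ∈ C_0^∞(Ω)`. -/
def IsWeakSolution (Ω : Set Plane) (v : Plane → ℝ) : Prop :=
  MemW2 2 Ω v ∧
    ∀ φ : Plane → ℝ, IsTestFunction ⊤ Ω φ →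
      ∫ x in Ω, ((∑ i : Fin 2, weakDeriv Ω i (weakDeriv Ω i v) x) *
            (∑ j : Fin 2, partialDeriv j (partialDeriv j φ) x) -
          ∑ k : Fin 2, flux Ω v k x * partialDeriv k φ x) = 0

/-- The integrand `∑_{i,j,p} v_{ijp} φ_{ijp} - ∑_p ((1 - |Dv|²) Dv)_p · Dφ_p`, where all
derivatives are weak derivatives on `U`. -/
def diffIntegrand (U : Set Plane) (v φ : Plane → ℝ) (x : Plane) : ℝ :=
  (∑ i : Fin 2, ∑ j : Fin 2, ∑ p : Fin 2,
      weakDeriv U p (weakDeriv U j (weakDeriv U i v)) x *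
        weakDeriv U p (weakDeriv U j (weakDeriv U i φ)) x) -
    ∑ p : Fin 2, ∑ k : Fin 2,
      weakDeriv U p (flux U v k) x * weakDeriv U k (weakDeriv U p φ) x

end

/-!
The idea is to differentiate the equation. Put `h = Δv` and let `F = (1 - |Dv|²) Dv` be the flux, so
that `Δh = - div F` weakly.

*The flux is square integrable.* In the plane `W^{1,2}` embeds locally into `L⁶`
(`memLp_six_of_hasWeakPartialDeriv`), so `Dv ∈ L⁶_loc`, and `F` is a cubic polynomial in `Dv`.

*Third derivatives.* An `L²` solution of `Δh = - div F` with `F ∈ L²` lies in `W^{1,2}_loc`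
(`exists_weakDeriv_of_laplacian_eq_div`). Indeed mollification turns `h` and `F` into smooth
solutions of the same linear equation, and the Caccioppoli inequality
(`integral_sq_partialDeriv_mul_cutoff_le`), applied to differences of mollifications, shows that
their gradients form a Cauchy sequence in `L²_loc`. This gives `Δv ∈ W^{1,2}_loc`. The equation
`Δ v_{ij} = ∂_i ((Δv)_j)` is again of this form, so the same result gives
`v_{ij} ∈ W^{1,2}_loc` (`IsWeakSolution.memW2_three`).

*Derivatives of the flux.* Now `Dv` and `D²v` are both in `L⁶_loc`, and the product rule
(`HasWeakPartialDeriv.mul`) together with Hölder's inequality gives `F ∈ W^{1,2}_loc`.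

*The differentiated equation.* For a smooth test function `φ` one moves all derivatives to `φ` and
tests the equation with `φ_{pp}` (`sum_integral_third_eq`). A general compactly supported
`φ ∈ W^{3,2}` is approximated by its mollifications (`exists_isTestFunction_tendsto`).
-/

open Filter Topology

/-! ### Partial derivatives and test functions -/

theorem ContDiff.partialDeriv {f : Plane → ℝ} (hf : ContDiff ℝ ∞ f) (i : Fin 2) :
    ContDiff ℝ ∞ (partialDeriv i f) := by
  unfold _root_.partialDeriv
  exact (hf.fderiv_right (m := ∞) (by simp)).clm_apply contDiff_const

theorem tsupport_partialDeriv_subset (i : Fin 2) (f : Plane → ℝ) :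
    tsupport (partialDeriv i f) ⊆ tsupport f :=
  tsupport_fderiv_apply_subset ℝ _

theorem HasCompactSupport.partialDeriv {f : Plane → ℝ} (hf : HasCompactSupport f) (i : Fin 2) :
    HasCompactSupport (partialDeriv i f) :=
  hf.fderiv_apply (𝕜 := ℝ) _

namespace IsTestFunction

variable {Ω U : Set Plane} {φ ψ : Plane → ℝ}

theorem contDiff (h : IsTestFunction ⊤ Ω φ) : ContDiff ℝ ∞ φ := h.1

theorem continuous (h : IsTestFunction ⊤ Ω φ) : Continuous φ := h.1.continuous

theorem partialDeriv (h : IsTestFunction ⊤ Ω φ) (i : Fin 2) :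
    IsTestFunction ⊤ Ω (partialDeriv i φ) :=
  ⟨h.contDiff.partialDeriv i, h.2.1.partialDeriv i, (tsupport_partialDeriv_subset i φ).trans h.2.2⟩

theorem mono (h : IsTestFunction ⊤ U φ) (hU : U ⊆ Ω) : IsTestFunction ⊤ Ω φ :=
  ⟨h.1, h.2.1, h.2.2.trans hU⟩

theorem smul_smooth (h : IsTestFunction ⊤ Ω φ) {f : Plane → ℝ} (hf : ContDiff ℝ ∞ f) :
    IsTestFunction ⊤ Ω (fun x => f x * φ x) :=
  ⟨hf.mul h.1, h.2.1.mul_left, (tsupport_mul_subset_right).trans h.2.2⟩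

theorem add (h : IsTestFunction ⊤ Ω φ) (h' : IsTestFunction ⊤ Ω ψ) :
    IsTestFunction ⊤ Ω (fun x => φ x + ψ x) :=
  ⟨h.1.add h'.1, h.2.1.add h'.2.1, (tsupport_add φ ψ).trans (Set.union_subset h.2.2 h'.2.2)⟩

theorem eq_zero (h : IsTestFunction ⊤ Ω φ) {x : Plane} (hx : x ∉ Ω) : φ x = 0 :=
  image_eq_zero_of_notMem_tsupport fun h' => hx (h.2.2 h')

end IsTestFunction

theorem partialDeriv_comm {f : Plane → ℝ} (hf : ContDiff ℝ ∞ f) (i j : Fin 2) :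
    partialDeriv i (partialDeriv j f) = partialDeriv j (partialDeriv i f) := by
  ext x
  have hd : Differentiable ℝ (fderiv ℝ f) :=
    (hf.fderiv_right (m := ∞) (by simp)).differentiable (by simp)
  have key : ∀ k l : Fin 2, partialDeriv k (partialDeriv l f) x =
      fderiv ℝ (fderiv ℝ f) x (EuclideanSpace.single k 1) (EuclideanSpace.single l 1) := by
    intro k l
    unfold partialDeriv
    rw [fderiv_clm_apply (hd x) (by fun_prop)]
    simp
  rw [key, key]
  have h2 : minSmoothness ℝ 2 ≤ ∞ := by simpa using WithTop.coe_le_coe.2 (le_top : (2 : ℕ∞) ≤ ⊤)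
  exact (hf.contDiffAt.isSymmSndFDerivAt h2).eq _ _

theorem partialDeriv_mul {f g : Plane → ℝ} (hf : ContDiff ℝ ∞ f) (hg : ContDiff ℝ ∞ g)
    (i : Fin 2) (x : Plane) :
    partialDeriv i (fun y => f y * g y) x =
      partialDeriv i f x * g x + f x * partialDeriv i g x := by
  unfold partialDeriv
  rw [fderiv_fun_mul (hf.differentiable (by simp) x) (hg.differentiable (by simp) x)]
  simp; ring

theorem partialDeriv_sub {f g : Plane → ℝ} (hf : ContDiff ℝ ∞ f) (hg : ContDiff ℝ ∞ g)
    (i : Fin 2) (x : Plane) :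
    partialDeriv i (fun y => f y - g y) x = partialDeriv i f x - partialDeriv i g x := by
  unfold partialDeriv
  rw [fderiv_fun_sub (hf.differentiable (by simp) x) (hg.differentiable (by simp) x)]
  simp

theorem partialDeriv_add {f g : Plane → ℝ} (hf : ContDiff ℝ ∞ f) (hg : ContDiff ℝ ∞ g)
    (i : Fin 2) (x : Plane) :
    partialDeriv i (fun y => f y + g y) x = partialDeriv i f x + partialDeriv i g x := by
  unfold partialDeriv
  rw [fderiv_fun_add (hf.differentiable (by simp) x) (hg.differentiable (by simp) x)]
  simp

/-- Reflecting and translating a test function changes the sign of its first derivatives. -/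
theorem partialDeriv_comp_sub_left {f : Plane → ℝ} (hf : ContDiff ℝ ∞ f) (i : Fin 2)
    (x y : Plane) : partialDeriv i (fun y => f (x - y)) y = - partialDeriv i f (x - y) := by
  have h : HasFDerivAt (fun y => f (x - y)) _ y :=
    ((hf.differentiable (by simp) (x - y)).hasFDerivAt).comp y ((hasFDerivAt_id y).const_sub x)
  unfold partialDeriv
  rw [h.fderiv]
  simp

/-! ### Integrals against test functions -/

theorem MeasureTheory.LocallyIntegrableOn.integrable_mul_test {Ω : Set Plane} {f φ : Plane → ℝ}
    (hf : LocallyIntegrableOn f Ω) (hφ : IsTestFunction ⊤ Ω φ) :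
    Integrable (fun x => f x * φ x) := by
  have h1 : IntegrableOn f (tsupport φ) := hf.integrableOn_compact_subset hφ.2.2 hφ.2.1
  have h2 : IntegrableOn (fun x => f x * φ x) (tsupport φ) :=
    h1.mul_continuousOn hφ.continuous.continuousOn hφ.2.1
  refine (integrableOn_iff_integrable_of_support_subset ?_).1 h2
  exact (Function.support_mul_subset_right f φ).trans (subset_tsupport φ)

theorem setIntegral_mul_test {Ω : Set Plane} {f φ : Plane → ℝ} (hφ : IsTestFunction ⊤ Ω φ) :
    ∫ x in Ω, f x * φ x = ∫ x, f x * φ x :=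
  setIntegral_eq_integral_of_forall_compl_eq_zero fun x hx => by rw [hφ.eq_zero hx, mul_zero]

theorem MeasureTheory.MemLp.locallyIntegrableOn_restrict {Ω : Set Plane} {f : Plane → ℝ}
    {p : ENNReal} (hf : MemLp f p (volume.restrict Ω)) (hp : 1 ≤ p) : LocallyIntegrableOn f Ω :=
  locallyIntegrableOn_of_locallyIntegrable_restrict (hf.locallyIntegrable hp)

theorem integral_mul_partialDeriv {f φ : Plane → ℝ} {Ω : Set Plane} (hf : ContDiff ℝ ∞ f)
    (hφ : IsTestFunction ⊤ Ω φ) (i : Fin 2) :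
    ∫ x, f x * partialDeriv i φ x = - ∫ x, partialDeriv i f x * φ x := by
  have hl : ∀ {g : Plane → ℝ}, ContDiff ℝ ∞ g → LocallyIntegrableOn g Ω := fun hg =>
    hg.continuous.locallyIntegrable.locallyIntegrableOn _
  exact integral_mul_fderiv_eq_neg_fderiv_mul_of_integrable
    ((hl (hf.partialDeriv i)).integrable_mul_test hφ)
    ((hl hf).integrable_mul_test (hφ.partialDeriv i)) ((hl hf).integrable_mul_test hφ)
    (fun x _ => hf.differentiable (by simp) x) (fun x _ => hφ.contDiff.differentiable (by simp) x)

/-! ### Weak derivatives -/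

namespace HasWeakPartialDeriv

variable {Ω U : Set Plane} {i : Fin 2} {f f' g g' : Plane → ℝ}

theorem integral_eq (h : HasWeakPartialDeriv Ω i f g) {φ : Plane → ℝ}
    (hφ : IsTestFunction ⊤ Ω φ) : ∫ x, f x * partialDeriv i φ x = - ∫ x, g x * φ x := by
  have := h.2.2 φ hφ
  rwa [setIntegral_mul_test (hφ.partialDeriv i), setIntegral_mul_test hφ] at this

theorem of_integral_eq (hf : LocallyIntegrableOn f Ω) (hg : LocallyIntegrableOn g Ω)
    (h : ∀ φ, IsTestFunction ⊤ Ω φ → ∫ x, f x * partialDeriv i φ x = - ∫ x, g x * φ x) :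
    HasWeakPartialDeriv Ω i f g :=
  ⟨hf, hg, fun φ hφ => by
    rw [setIntegral_mul_test (hφ.partialDeriv i), setIntegral_mul_test hφ, h φ hφ]⟩

theorem mono (h : HasWeakPartialDeriv Ω i f g) (hU : U ⊆ Ω) : HasWeakPartialDeriv U i f g :=
  of_integral_eq (h.1.mono_set hU) (h.2.1.mono_set hU) fun _ hφ => h.integral_eq (hφ.mono hU)

theorem congr (h : HasWeakPartialDeriv Ω i f g) (hf : f =ᵐ[volume.restrict Ω] f')
    (hg : g =ᵐ[volume.restrict Ω] g') : HasWeakPartialDeriv Ω i f' g' := by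
  refine ⟨h.1.congr hf, h.2.1.congr hg, fun φ hφ => ?_⟩
  have h1 := integral_congr_ae (hf.mul (EventuallyEq.refl _ (partialDeriv i φ)))
  have h2 := integral_congr_ae (hg.mul (EventuallyEq.refl _ φ))
  simp only [Pi.mul_apply] at h1 h2
  rw [← h1, ← h2]
  exact h.2.2 φ hφ

theorem unique (hΩ : IsOpen Ω) (h : HasWeakPartialDeriv Ω i f g)
    (h' : HasWeakPartialDeriv Ω i f g') : g =ᵐ[volume.restrict Ω] g' := by
  have : ∀ᵐ x, x ∈ Ω → (g - g') x = 0 := by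
    refine hΩ.ae_eq_zero_of_integral_contDiff_smul_eq_zero (h.2.1.sub h'.2.1) ?_
    intro φ h1 h2 h3
    have hφ : IsTestFunction ⊤ Ω φ := ⟨h1, h2, h3⟩
    have e : ∀ x, φ x • (g - g') x = g x * φ x - g' x * φ x := fun x => by
      simp only [Pi.sub_apply, smul_eq_mul]; ring
    simp_rw [e]
    rw [integral_sub (h.2.1.integrable_mul_test hφ) (h'.2.1.integrable_mul_test hφ)]
    linarith [h.integral_eq hφ, h'.integral_eq hφ]
  rw [EventuallyEq, ae_restrict_iff' hΩ.measurableSet]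
  filter_upwards [this] with x hx hxΩ
  simpa [sub_eq_zero] using hx hxΩ

theorem of_smooth (hf : ContDiff ℝ ∞ f) (i : Fin 2) :
    HasWeakPartialDeriv Ω i f (partialDeriv i f) :=
  of_integral_eq (hf.continuous.locallyIntegrable.locallyIntegrableOn _)
    ((hf.partialDeriv i).continuous.locallyIntegrable.locallyIntegrableOn _)
    fun _ hφ => integral_mul_partialDeriv hf hφ i

theorem neg (h : HasWeakPartialDeriv Ω i f g) :
    HasWeakPartialDeriv Ω i (fun x => - f x) (fun x => - g x) := by
  refine of_integral_eq h.1.neg h.2.1.neg fun φ hφ => ?_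
  simp only [neg_mul, integral_neg, h.integral_eq hφ]

theorem add (h : HasWeakPartialDeriv Ω i f g) (h' : HasWeakPartialDeriv Ω i f' g') :
    HasWeakPartialDeriv Ω i (fun x => f x + f' x) (fun x => g x + g' x) := by
  refine of_integral_eq (h.1.add h'.1) (h.2.1.add h'.2.1) fun φ hφ => ?_
  simp only [add_mul]
  rw [integral_add (h.1.integrable_mul_test (hφ.partialDeriv i))
      (h'.1.integrable_mul_test (hφ.partialDeriv i)),
    integral_add (h.2.1.integrable_mul_test hφ) (h'.2.1.integrable_mul_test hφ),
    h.integral_eq hφ, h'.integral_eq hφ]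
  ring

theorem ae_weakDeriv (hΩ : IsOpen Ω) (h : HasWeakPartialDeriv Ω i f g) :
    weakDeriv Ω i f =ᵐ[volume.restrict Ω] g := by
  have he : ∃ g, HasWeakPartialDeriv Ω i f g := ⟨g, h⟩
  unfold weakDeriv
  rw [dif_pos he]
  exact he.choose_spec.unique hΩ h

theorem weakDeriv (hΩ : IsOpen Ω) (h : HasWeakPartialDeriv Ω i f g) :
    HasWeakPartialDeriv Ω i f (weakDeriv Ω i f) :=
  h.congr (EventuallyEq.refl _ _) (h.ae_weakDeriv hΩ).symm

/-- The weak derivative vanishes where the function does. -/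
theorem ae_eq_zero (hΩ : IsOpen Ω) (h : HasWeakPartialDeriv Ω i f g)
    (hf : f =ᵐ[volume.restrict Ω] 0) : g =ᵐ[volume.restrict Ω] 0 := by
  refine h.unique hΩ ((?_ : HasWeakPartialDeriv Ω i 0 0).congr hf.symm (EventuallyEq.refl _ _))
  have h0 : LocallyIntegrableOn (0 : Plane → ℝ) Ω := locallyIntegrableOn_zero
  exact of_integral_eq h0 h0 fun φ _ => by simp

end HasWeakPartialDeriv

/-! ### Convolution with smooth kernels -/

/-- The convolution `∫ ρ(t) F(x - t) dt`. -/
noncomputable def conv (ρ F : Plane → ℝ) : Plane → ℝ :=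
  convolution ρ F (ContinuousLinearMap.lsmul ℝ ℝ) volume

theorem conv_eq_swap (ρ F : Plane → ℝ) (x : Plane) : conv ρ F x = ∫ y, F y * ρ (x - y) := by
  unfold conv
  rw [convolution_lsmul_swap]
  simp only [smul_eq_mul, mul_comm]

theorem contDiff_conv {ρ F : Plane → ℝ} (hρ : ContDiff ℝ ∞ ρ) (hc : HasCompactSupport ρ)
    (hF : LocallyIntegrable F) : ContDiff ℝ ∞ (conv ρ F) :=
  hc.contDiff_convolution_left _ hρ hF

theorem partialDeriv_conv {ρ F : Plane → ℝ} (hρ : ContDiff ℝ ∞ ρ) (hc : HasCompactSupport ρ)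
    (hF : LocallyIntegrable F) (i : Fin 2) :
    partialDeriv i (conv ρ F) = conv (partialDeriv i ρ) F := by
  ext x
  have h := hc.hasFDerivAt_convolution_left (ContinuousLinearMap.lsmul ℝ ℝ)
    (hρ.of_le (by simp)) hF x
  unfold conv
  unfold partialDeriv
  rw [h.fderiv, convolution_def, convolution_def, ContinuousLinearMap.integral_apply]
  · simp
  · exact ((hc.fderiv (𝕜 := ℝ)).convolutionExists_left _
      (hρ.continuous_fderiv (by simp)) hF x)

/-- Extending `f` by zero does not matter as long as the translated kernel is supported in `Ω`. -/
theorem conv_indicator {Ω : Set Plane} {ρ f : Plane → ℝ} {x : Plane}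
    (h : IsTestFunction ⊤ Ω (fun y => ρ (x - y))) :
    conv ρ (Ω.indicator f) x = ∫ y, f y * ρ (x - y) := by
  rw [conv_eq_swap]
  refine integral_congr_ae (Eventually.of_forall fun y => ?_)
  by_cases hy : y ∈ Ω
  · simp [hy]
  · simp [hy, h.eq_zero hy]

/-- The smooth nonnegative kernel of integral one, supported in the ball of radius `1 / (n + 1)`. -/
noncomputable def mollifierBump (n : ℕ) : ContDiffBump (0 : Plane) where
  rIn := ((n : ℝ) + 1)⁻¹ / 2
  rOut := ((n : ℝ) + 1)⁻¹
  rIn_pos := by positivity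
  rIn_lt_rOut := half_lt_self (by positivity)

/-- The normalized kernel attached to `mollifierBump`. -/
noncomputable def mollifier (n : ℕ) : Plane → ℝ := (mollifierBump n).normed volume

theorem tendsto_mollifierBump_rOut : Tendsto (fun n => (mollifierBump n).rOut) atTop (𝓝 0) :=
  (tendsto_one_div_add_atTop_nhds_zero_nat (𝕜 := ℝ)).congr fun n => by simp [mollifierBump]

theorem contDiff_mollifier (n : ℕ) : ContDiff ℝ ∞ (mollifier n) :=
  (mollifierBump n).contDiff_normed

theorem hasCompactSupport_mollifier (n : ℕ) : HasCompactSupport (mollifier n) :=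
  (mollifierBump n).hasCompactSupport_normed

theorem support_mollifier (n : ℕ) :
    Function.support (mollifier n) = Metric.ball 0 (mollifierBump n).rOut :=
  (mollifierBump n).support_normed_eq

/-- Mollification of `f`, extended by zero outside `Ω`. -/
noncomputable def mollify (Ω : Set Plane) (n : ℕ) (f : Plane → ℝ) : Plane → ℝ :=
  conv (mollifier n) (Ω.indicator f)

theorem IsTestFunction.translate_mollifier {Ω : Set Plane} {n : ℕ} {x : Plane}
    (h : Metric.closedBall x (mollifierBump n).rOut ⊆ Ω) :
    IsTestFunction ⊤ Ω (fun y => mollifier n (x - y)) := by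
  have hs : Function.support (fun y => mollifier n (x - y)) ⊆
      Metric.closedBall x (mollifierBump n).rOut := by
    intro y hy
    have : x - y ∈ Function.support (mollifier n) := hy
    rw [support_mollifier, mem_ball_zero_iff] at this
    rw [Metric.mem_closedBall, dist_comm, dist_eq_norm]
    exact this.le
  exact ⟨(contDiff_mollifier n).comp (contDiff_const.sub contDiff_id),
    HasCompactSupport.of_support_subset_isCompact (isCompact_closedBall _ _) hs,
    (closure_minimal hs Metric.isClosed_closedBall).trans h⟩

theorem eventually_isTestFunction_translate {Ω K : Set Plane} (hΩ : IsOpen Ω) (hK : IsCompact K)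
    (hKΩ : K ⊆ Ω) :
    ∀ᶠ n in atTop, ∀ x ∈ K, IsTestFunction ⊤ Ω (fun y => mollifier n (x - y)) := by
  obtain ⟨δ, hδ, hδΩ⟩ := hK.exists_cthickening_subset_open hΩ hKΩ
  filter_upwards [tendsto_mollifierBump_rOut.eventually (Iio_mem_nhds hδ)] with n hn x hx
  refine IsTestFunction.translate_mollifier (subset_trans ?_ hδΩ)
  exact (Metric.closedBall_subset_closedBall (le_of_lt hn)).trans
    (Metric.closedBall_subset_cthickening hx δ)

theorem MeasureTheory.MemLp.indicator_restrict {Ω : Set Plane} (hΩ : IsOpen Ω) {f : Plane → ℝ}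
    {p : ENNReal} (hf : MemLp f p (volume.restrict Ω)) : MemLp (Ω.indicator f) p volume :=
  (memLp_indicator_iff_restrict hΩ.measurableSet).2 hf

theorem contDiff_mollify {Ω : Set Plane} (hΩ : IsOpen Ω) {f : Plane → ℝ}
    (hf : MemLp f 2 (volume.restrict Ω)) (n : ℕ) : ContDiff ℝ ∞ (mollify Ω n f) :=
  contDiff_conv (contDiff_mollifier n) (hasCompactSupport_mollifier n)
    ((hf.indicator_restrict hΩ).locallyIntegrable (by norm_num))

/-- Away from the boundary, mollification commutes with weak differentiation. -/
theorem partialDeriv_mollify {Ω : Set Plane} (hΩ : IsOpen Ω) {f g : Plane → ℝ} {i : Fin 2} {n : ℕ}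
    (hf : MemLp f 2 (volume.restrict Ω)) (hfg : HasWeakPartialDeriv Ω i f g) {x : Plane}
    (hx : IsTestFunction ⊤ Ω (fun y => mollifier n (x - y))) :
    partialDeriv i (mollify Ω n f) x = mollify Ω n g x := by
  have hs : ∀ y, partialDeriv i (fun y => mollifier n (x - y)) y =
      - partialDeriv i (mollifier n) (x - y) :=
    fun y => partialDeriv_comp_sub_left (contDiff_mollifier n) i x y
  have hd : IsTestFunction ⊤ Ω (fun y => partialDeriv i (mollifier n) (x - y)) := by
    have h := (hx.partialDeriv i).smul_smooth (contDiff_const (c := (-1 : ℝ)))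
    simpa [hs] using h
  unfold mollify
  rw [partialDeriv_conv (contDiff_mollifier n) (hasCompactSupport_mollifier n)
    ((hf.indicator_restrict hΩ).locallyIntegrable (by norm_num)), conv_indicator hd,
    conv_indicator hx]
  have := hfg.integral_eq hx
  simp only [hs, mul_neg, integral_neg] at this
  linarith

/-! ### Convergence of mollifications in `L²` -/

theorem mollifier_nonneg (n : ℕ) (x : Plane) : 0 ≤ mollifier n x :=
  (mollifierBump n).nonneg_normed x

theorem lintegral_mollifier (n : ℕ) : ∫⁻ x, ENNReal.ofReal (mollifier n x) = 1 := by
  have h : ∫ x, mollifier n x = 1 := (mollifierBump n).integral_normed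
  rw [← ofReal_integral_eq_lintegral_ofReal (f := mollifier n)
    (mollifierBump n).integrable_normed (Eventually.of_forall (mollifier_nonneg n)), h]
  simp

theorem lintegral_sq_conv_mollifier_le {f : Plane → ℝ} (hf : Measurable f) (n : ℕ) :
    ∫⁻ x, ‖conv (mollifier n) f x‖ₑ ^ (2 : ℝ) ≤ ∫⁻ x, ‖f x‖ₑ ^ (2 : ℝ) := by
  set k : Plane → ENNReal := fun t => ENNReal.ofReal (mollifier n t) with hk
  have hkm : Measurable k := (contDiff_mollifier n).continuous.measurable.ennreal_ofReal
  have hpt : ∀ x, ‖conv (mollifier n) f x‖ₑ ^ (2 : ℝ) ≤ ∫⁻ t, k t * ‖f (x - t)‖ₑ ^ (2 : ℝ) := by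
    intro x
    have hm : Measurable fun t => ‖f (x - t)‖ₑ := by fun_prop
    have h1 : ‖conv (mollifier n) f x‖ₑ ≤ ∫⁻ t, k t * ‖f (x - t)‖ₑ := by
      unfold conv
      rw [convolution_lsmul]
      refine (enorm_integral_le_lintegral_enorm _).trans_eq (lintegral_congr fun t => ?_)
      rw [enorm_smul, hk, Real.enorm_of_nonneg (mollifier_nonneg n t)]
    -- Jensen's inequality for the probability density `k`.
    have h2 := ENNReal.lintegral_mul_le_Lp_mul_Lq (volume.withDensity k)
      Real.HolderConjugate.two_two hm.aemeasurable (aemeasurable_const (b := (1 : ENNReal)))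
    have h3 : ∫⁻ t, k t * ‖f (x - t)‖ₑ ≤
        (∫⁻ t, k t * ‖f (x - t)‖ₑ ^ (2 : ℝ)) ^ (1 / 2 : ℝ) := by
      have e1 : (volume.withDensity k) Set.univ = 1 := by
        rw [withDensity_apply _ MeasurableSet.univ, Measure.restrict_univ]
        exact lintegral_mollifier n
      rw [lintegral_withDensity_eq_lintegral_mul _ hkm (hm.mul measurable_const),
        lintegral_withDensity_eq_lintegral_mul _ hkm (hm.pow_const _)] at h2
      simpa [e1] using h2
    calc ‖conv (mollifier n) f x‖ₑ ^ (2 : ℝ)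
        ≤ ((∫⁻ t, k t * ‖f (x - t)‖ₑ ^ (2 : ℝ)) ^ (1 / 2 : ℝ)) ^ (2 : ℝ) :=
          ENNReal.rpow_le_rpow (h1.trans h3) (by norm_num)
      _ = _ := by rw [← ENNReal.rpow_mul]; norm_num
  calc ∫⁻ x, ‖conv (mollifier n) f x‖ₑ ^ (2 : ℝ)
      ≤ ∫⁻ x, ∫⁻ t, k t * ‖f (x - t)‖ₑ ^ (2 : ℝ) := lintegral_mono hpt
    _ = ∫⁻ t, ∫⁻ x, k t * ‖f (x - t)‖ₑ ^ (2 : ℝ) := by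
        refine lintegral_lintegral_swap (Measurable.aemeasurable ?_)
        unfold Function.uncurry
        fun_prop
    _ = ∫⁻ t, k t * ∫⁻ x, ‖f x‖ₑ ^ (2 : ℝ) := by
        refine lintegral_congr fun t => ?_
        rw [lintegral_const_mul _ (by fun_prop)]
        rw [lintegral_sub_right_eq_self (fun x => ‖f x‖ₑ ^ (2 : ℝ)) t]
    _ = ∫⁻ x, ‖f x‖ₑ ^ (2 : ℝ) := by
        rw [lintegral_mul_const _ hkm, lintegral_mollifier, one_mul]

/-- Young's inequality in `L²` for the mollifiers, which have integral one. -/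
theorem eLpNorm_conv_mollifier_le {f : Plane → ℝ} (hf : AEStronglyMeasurable f volume) (n : ℕ) :
    eLpNorm (conv (mollifier n) f) 2 volume ≤ eLpNorm f 2 volume := by
  have hc : conv (mollifier n) f = conv (mollifier n) (hf.mk f) :=
    convolution_congr _ (EventuallyEq.refl _ _) hf.ae_eq_mk
  rw [hc, eLpNorm_congr_ae hf.ae_eq_mk]
  have := lintegral_sq_conv_mollifier_le hf.stronglyMeasurable_mk.measurable n
  have h2 : ∀ g : Plane → ℝ, eLpNorm g 2 volume ^ (2 : ℝ) = ∫⁻ x, ‖g x‖ₑ ^ (2 : ℝ) := fun g => by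
    have := eLpNorm_nnreal_pow_eq_lintegral (μ := (volume : Measure Plane)) (f := g) (p := 2)
      (by norm_num)
    simpa using this
  rwa [← h2, ← h2, ENNReal.rpow_le_rpow_iff (by norm_num)] at this

theorem tendsto_eLpNorm_conv_sub_of_continuous {g : Plane → ℝ} (hg : Continuous g)
    (hc : HasCompactSupport g) :
    Tendsto (fun n => eLpNorm (conv (mollifier n) g - g) 2 volume) atTop (𝓝 0) := by
  set K := Metric.cthickening 1 (tsupport g) with hK
  have hKc : IsCompact K := hc.cthickening
  have hsup : ∀ n, Function.support (conv (mollifier n) g - g) ⊆ K := by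
    intro n x hx
    by_contra hxK
    have hz : ∀ y ∈ Metric.closedBall x 1, g y = 0 := by
      intro y hy
      refine image_eq_zero_of_notMem_tsupport fun hy' => hxK ?_
      exact Metric.mem_cthickening_of_dist_le x y 1 _ hy' (by simpa [dist_comm] using hy)
    refine hx ?_
    have h0 : g x = 0 := hz x (by simp)
    simp only [Pi.sub_apply, h0, sub_zero]
    unfold conv mollifier
    rw [(mollifierBump n).normed_convolution_eq_right, h0]
    intro y hy
    rw [h0, hz y]
    refine Metric.closedBall_subset_closedBall ?_ (Metric.ball_subset_closedBall hy)
    simp only [mollifierBump]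
    exact inv_le_one_of_one_le₀ (by linarith [n.cast_nonneg (α := ℝ)])
  have huc : UniformContinuous g := hc.uniformContinuous_of_continuous hg
  rw [ENNReal.tendsto_atTop_zero]
  intro ε hε
  set M : ENNReal := volume K ^ (2 : ENNReal).toReal⁻¹ with hM
  have hMt : M ≠ ⊤ := ENNReal.rpow_ne_top_of_nonneg (by positivity) hKc.measure_lt_top.ne
  obtain ⟨δ, hδ, hδε⟩ : ∃ δ : ℝ, 0 < δ ∧ M * ENNReal.ofReal δ ≤ ε := by
    have ht : Tendsto (fun δ : ℝ => M * ENNReal.ofReal δ) (𝓝[>] 0) (𝓝 (M * ENNReal.ofReal 0)) :=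
      ENNReal.Tendsto.const_mul
        ((ENNReal.continuous_ofReal.tendsto 0).mono_left nhdsWithin_le_nhds) (Or.inr hMt)
    simp only [ENNReal.ofReal_zero, mul_zero] at ht
    obtain ⟨δ, h1, h2⟩ := ((ht.eventually (Iio_mem_nhds hε)).and self_mem_nhdsWithin).exists
    exact ⟨δ, h2, le_of_lt h1⟩
  obtain ⟨r, hr, hgr⟩ := Metric.uniformContinuous_iff.1 huc δ hδ
  obtain ⟨N, hN⟩ := eventually_atTop.1 (tendsto_mollifierBump_rOut.eventually (Iio_mem_nhds hr))
  refine ⟨N, fun n hn => ?_⟩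
  rw [← eLpNorm_restrict_eq_of_support_subset (hsup n)]
  refine (eLpNorm_le_of_ae_bound (C := δ) (Eventually.of_forall fun x => ?_)).trans ?_
  · rw [Pi.sub_apply, ← dist_eq_norm]
    refine (mollifierBump n).dist_normed_convolution_le hg.aestronglyMeasurable fun y hy => ?_
    exact (hgr (lt_trans (Metric.mem_ball.1 hy) (hN n hn))).le
  · rw [Measure.restrict_apply_univ]
    exact hδε

theorem tendsto_eLpNorm_conv_sub {f : Plane → ℝ} (hf : MemLp f 2 volume) :
    Tendsto (fun n => eLpNorm (conv (mollifier n) f - f) 2 volume) atTop (𝓝 0) := by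
  rw [ENNReal.tendsto_atTop_zero]
  intro ε hε
  have hε3 : ε / 3 ≠ 0 := by simp [hε.ne']
  obtain ⟨g, hgc, hgε, hg, hgL⟩ := hf.exists_hasCompactSupport_eLpNorm_sub_le (by norm_num) hε3
  obtain ⟨N, hN⟩ := ENNReal.tendsto_atTop_zero.1
    (tendsto_eLpNorm_conv_sub_of_continuous hg hgc) (ε / 3) (pos_iff_ne_zero.2 hε3)
  refine ⟨N, fun n hn => ?_⟩
  have hfl : LocallyIntegrable f := hf.locallyIntegrable (by norm_num)
  have hgl : LocallyIntegrable g := hg.locallyIntegrable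
  have hm : ∀ {u : Plane → ℝ}, LocallyIntegrable u →
      AEStronglyMeasurable (conv (mollifier n) u) volume := fun hu =>
    (contDiff_conv (contDiff_mollifier n) (hasCompactSupport_mollifier n)
      hu).continuous.aestronglyMeasurable
  have hsub : conv (mollifier n) (f - g) = conv (mollifier n) f - conv (mollifier n) g := by
    ext x
    have e : ∀ {u : Plane → ℝ}, LocallyIntegrable u →
        ConvolutionExistsAt (mollifier n) u x (ContinuousLinearMap.lsmul ℝ ℝ) volume := fun hu =>
      (hasCompactSupport_mollifier n).convolutionExists_left _
        (contDiff_mollifier n).continuous hu x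
    unfold conv
    rw [Pi.sub_apply, convolution_def, convolution_def, convolution_def,
      ← integral_sub (e hfl) (e hgl)]
    simp only [Pi.sub_apply, map_sub]
  have hdec : conv (mollifier n) f - f =
      conv (mollifier n) (f - g) + (conv (mollifier n) g - g) + (g - f) := by
    rw [hsub]; abel
  rw [hdec]
  have hA : AEStronglyMeasurable (conv (mollifier n) (f - g)) volume := hm (hfl.sub hgl)
  have hB : AEStronglyMeasurable (conv (mollifier n) g - g) volume := (hm hgl).sub hgL.1
  refine (eLpNorm_add_le (hA.add hB) (hgL.1.sub hf.1) (by norm_num)).trans ?_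
  refine (add_le_add (eLpNorm_add_le hA hB (by norm_num)) le_rfl).trans ?_
  have h1 := (eLpNorm_conv_mollifier_le (hf.1.sub hgL.1) n).trans hgε
  have h3 : eLpNorm (g - f) 2 volume ≤ ε / 3 := by rw [eLpNorm_sub_comm]; exact hgε
  calc _ ≤ ε / 3 + ε / 3 + ε / 3 := add_le_add (add_le_add h1 (hN n hn)) h3
    _ = ε := ENNReal.add_thirds ε

/-- Mollifications converge in `L²(Ω)`. -/
theorem tendsto_eLpNorm_mollify_sub {Ω : Set Plane} (hΩ : IsOpen Ω) {f : Plane → ℝ}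
    (hf : MemLp f 2 (volume.restrict Ω)) :
    Tendsto (fun n => eLpNorm (mollify Ω n f - f) 2 (volume.restrict Ω)) atTop (𝓝 0) := by
  refine tendsto_of_tendsto_of_tendsto_of_le_of_le tendsto_const_nhds
    (tendsto_eLpNorm_conv_sub (hf.indicator_restrict hΩ)) (fun _ => zero_le) fun n => ?_
  have : mollify Ω n f - f =ᵐ[volume.restrict Ω] mollify Ω n f - Ω.indicator f :=
    (EventuallyEq.refl _ _).sub (indicator_ae_eq_restrict hΩ.measurableSet).symm
  rw [eLpNorm_congr_ae this]
  exact eLpNorm_mono_measure _ Measure.restrict_le_self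

/-! ### Convergence in `L²` -/

section LTwo

variable {α : Type*} [MeasurableSpace α] {μ : Measure α}

theorem tendsto_integral_mul_of_tendsto_eLpNorm {ι : Type*} {l : Filter ι} {a : ι → α → ℝ}
    {b c : α → ℝ} (ha : ∀ᶠ n in l, MemLp (a n) 2 μ) (hb : MemLp b 2 μ) (hc : MemLp c 2 μ)
    (h : Tendsto (fun n => eLpNorm (a n - b) 2 μ) l (𝓝 0)) :
    Tendsto (fun n => ∫ x, a n x * c x ∂μ) l (𝓝 (∫ x, b x * c x ∂μ)) := by
  refine tendsto_integral_of_L1' _ (hb.integrable_mul hc).1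
    (ha.mono fun n hn => hn.integrable_mul hc) ?_
  have h0 : Tendsto (fun n => eLpNorm (a n - b) 2 μ * eLpNorm c 2 μ) l (𝓝 0) := by
    simpa using ENNReal.Tendsto.mul_const h (Or.inr hc.2.ne)
  refine tendsto_of_tendsto_of_tendsto_of_le_of_le' tendsto_const_nhds h0
    (Eventually.of_forall fun _ => zero_le) (ha.mono fun n hn => ?_)
  have e : (fun x => a n x * c x) - (b * c) = (a n - b) • c := by
    ext x; simp [sub_mul]
  rw [e]
  exact eLpNorm_smul_le_mul_eLpNorm hc.1 (hn.sub hb).1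

theorem exists_memLp_tendsto_of_cauchy {a : ℕ → α → ℝ} (ha : ∀ n, MemLp (a n) 2 μ)
    (h : Tendsto (fun q : ℕ × ℕ => eLpNorm (a q.1 - a q.2) 2 μ) atTop (𝓝 0)) :
    ∃ g, MemLp g 2 μ ∧ Tendsto (fun n => eLpNorm (a n - g) 2 μ) atTop (𝓝 0) := by
  have hc : CauchySeq fun n => (ha n).toLp (a n) := by
    rw [Lp.cauchySeq_Lp_iff_cauchySeq_eLpNorm]
    refine h.congr fun q => eLpNorm_congr_ae ?_
    exact ((ha q.1).coeFn_toLp.sub (ha q.2).coeFn_toLp).symm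
  obtain ⟨g, hg⟩ := cauchySeq_tendsto_of_complete hc
  refine ⟨g, Lp.memLp g, ?_⟩
  rw [Lp.tendsto_Lp_iff_tendsto_eLpNorm'] at hg
  exact hg.congr fun n => eLpNorm_congr_ae ((ha n).coeFn_toLp.sub (EventuallyEq.refl _ _))

theorem tendsto_eLpNorm_sub_prod {a : ℕ → α → ℝ} {b : α → ℝ}
    (ha : ∀ n, AEStronglyMeasurable (a n) μ) (hb : AEStronglyMeasurable b μ)
    (h : Tendsto (fun n => eLpNorm (a n - b) 2 μ) atTop (𝓝 0)) :
    Tendsto (fun q : ℕ × ℕ => eLpNorm (a q.1 - a q.2) 2 μ) atTop (𝓝 0) := by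
  have h1 := h.comp (tendsto_fst (f := atTop (α := ℕ)) (g := atTop (α := ℕ)))
  have h2 := h.comp (tendsto_snd (f := atTop (α := ℕ)) (g := atTop (α := ℕ)))
  rw [prod_atTop_atTop_eq] at h1 h2
  have h3 := h1.add h2
  rw [add_zero] at h3
  refine tendsto_of_tendsto_of_tendsto_of_le_of_le tendsto_const_nhds h3 (fun _ => zero_le)
    fun q => ?_
  have e : a q.1 - a q.2 = (a q.1 - b) + (b - a q.2) := by abel
  simp only [Function.comp_apply]
  rw [e, eLpNorm_sub_comm (a q.2) b]
  exact eLpNorm_add_le ((ha _).sub hb) (hb.sub (ha _)) (by norm_num)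

theorem eLpNorm_two_rpow_two (f : α → ℝ) :
    eLpNorm f 2 μ ^ (2 : ℝ) = ∫⁻ x, ENNReal.ofReal (f x ^ 2) ∂μ := by
  have := eLpNorm_nnreal_pow_eq_lintegral (μ := μ) (f := f) (p := 2) (by norm_num)
  rw [show ((2 : NNReal) : ENNReal) = 2 from rfl, show ((2 : NNReal) : ℝ) = 2 from rfl] at this
  rw [this]
  refine lintegral_congr fun x => ?_
  rw [← sq_abs, ENNReal.ofReal_pow (abs_nonneg _), ← Real.norm_eq_abs, ofReal_norm]
  exact ENNReal.rpow_natCast _ 2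

end LTwo

theorem MeasureTheory.MemLp.mono_set {U V : Set Plane} {f : Plane → ℝ} {p : ENNReal}
    (hf : MemLp f p (volume.restrict V)) (h : U ⊆ V) : MemLp f p (volume.restrict U) :=
  hf.mono_measure (Measure.restrict_mono h le_rfl)

theorem tendsto_eLpNorm_mono_set {ι : Type*} {l : Filter ι} {U V : Set Plane} (h : U ⊆ V)
    {p : ENNReal} {a : ι → Plane → ℝ}
    (ha : Tendsto (fun n => eLpNorm (a n) p (volume.restrict V)) l (𝓝 0)) :
    Tendsto (fun n => eLpNorm (a n) p (volume.restrict U)) l (𝓝 0) :=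
  tendsto_of_tendsto_of_tendsto_of_le_of_le tendsto_const_nhds ha (fun _ => zero_le)
    fun _ => eLpNorm_mono_measure _ (Measure.restrict_mono h le_rfl)

theorem Continuous.memLp_restrict_compact {f : Plane → ℝ} (hf : Continuous f) {U K : Set Plane}
    (hK : IsCompact K) (hU : U ⊆ K) (p : ENNReal) : MemLp f p (volume.restrict U) := by
  refine MemLp.mono_set (V := K) ?_ hU
  obtain ⟨C, hC⟩ := hK.exists_bound_of_continuousOn hf.continuousOn
  have : IsFiniteMeasure (volume.restrict K) := ⟨by simpa using hK.measure_lt_top⟩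
  refine MemLp.of_bound hf.aestronglyMeasurable C ?_
  exact (ae_restrict_iff' hK.measurableSet).2 (Eventually.of_forall hC)

theorem IsTestFunction.memLp {Ω : Set Plane} {φ : Plane → ℝ} (h : IsTestFunction ⊤ Ω φ)
    (p : ENNReal) (U : Set Plane) : MemLp φ p (volume.restrict U) :=
  (h.continuous.memLp_of_hasCompactSupport h.2.1).restrict U

/-- Weak differentiation is a closed operator in `L²`. -/
theorem HasWeakPartialDeriv.of_tendsto {U : Set Plane} {i : Fin 2} {a b : ℕ → Plane → ℝ}
    {f g : Plane → ℝ} (ha : ∀ᶠ n in atTop, MemLp (a n) 2 (volume.restrict U))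
    (hb : ∀ᶠ n in atTop, MemLp (b n) 2 (volume.restrict U))
    (hf : MemLp f 2 (volume.restrict U)) (hg : MemLp g 2 (volume.restrict U))
    (hab : ∀ᶠ n in atTop, HasWeakPartialDeriv U i (a n) (b n))
    (haf : Tendsto (fun n => eLpNorm (a n - f) 2 (volume.restrict U)) atTop (𝓝 0))
    (hbg : Tendsto (fun n => eLpNorm (b n - g) 2 (volume.restrict U)) atTop (𝓝 0)) :
    HasWeakPartialDeriv U i f g := by
  refine ⟨hf.locallyIntegrableOn_restrict (by norm_num),
    hg.locallyIntegrableOn_restrict (by norm_num), fun φ hφ => ?_⟩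
  have h1 := tendsto_integral_mul_of_tendsto_eLpNorm ha hf ((hφ.partialDeriv i).memLp 2 U) haf
  have h2 := (tendsto_integral_mul_of_tendsto_eLpNorm hb hg (hφ.memLp 2 U) hbg).neg
  refine tendsto_nhds_unique (h1.congr' ?_) h2
  exact hab.mono fun n hn => hn.2.2 φ hφ

/-! ### The Caccioppoli inequality -/

theorem exists_cutoff {Ω K : Set Plane} (hΩ : IsOpen Ω) (hK : IsCompact K) (hKΩ : K ⊆ Ω) :
    ∃ η : Plane → ℝ, IsTestFunction ⊤ Ω η ∧ ∀ᶠ x in 𝓝ˢ K, η x = 1 := by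
  obtain ⟨V, hV, hKV, hVΩ, hVc⟩ := exists_open_between_and_isCompact_closure hK hΩ hKΩ
  obtain ⟨η, h1, h0, -⟩ := exists_contMDiffMap_one_nhds_of_subset_interior
    (modelWithCornersSelf ℝ Plane) (n := ⊤) (t := V) hK.isClosed (by rwa [hV.interior_eq])
  have hs : Function.support η ⊆ V := fun x hx => by
    by_contra h
    exact hx (h0 x h)
  exact ⟨η, ⟨η.contMDiff.contDiff,
    HasCompactSupport.of_support_subset_isCompact hVc (hs.trans subset_closure),
    (closure_mono hs).trans hVΩ⟩, h1⟩

theorem IsTestFunction.integrable {Ω : Set Plane} {φ : Plane → ℝ} (h : IsTestFunction ⊤ Ω φ) :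
    Integrable φ :=
  h.continuous.integrable_of_hasCompactSupport h.2.1

/-- The Caccioppoli inequality: smooth solutions of `Δh = - div F` satisfy an interior energy
estimate, obtained by testing the equation with `η² h`. -/
theorem integral_sq_partialDeriv_mul_cutoff_le {h η : Plane → ℝ} {F : Fin 2 → Plane → ℝ}
    {Ω : Set Plane} (hh : ContDiff ℝ ∞ h) (hF : ∀ k, ContDiff ℝ ∞ (F k))
    (hη : IsTestFunction ⊤ Ω η)
    (heq : ∀ x ∈ tsupport η,
      ∑ k, partialDeriv k (partialDeriv k h) x + ∑ k, partialDeriv k (F k) x = 0) :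
    ∫ x, ∑ k, partialDeriv k (fun y => h y * η y) x ^ 2 ≤
      ∫ x, ∑ k, (2 * (F k x * η x) ^ 2 + 3 * (h x * partialDeriv k η x) ^ 2) := by
  have hu : IsTestFunction ⊤ Ω (fun y => h y * η y) := hη.smul_smooth hh
  have hψ : IsTestFunction ⊤ Ω (fun y => η y * (h y * η y)) := hu.smul_smooth hη.contDiff
  set ψ := fun y => η y * (h y * η y)
  set f : Fin 2 → Plane → ℝ := fun k y => partialDeriv k h y + F k y with hf
  have hfs : ∀ k, ContDiff ℝ ∞ (f k) := fun k => (hh.partialDeriv k).add (hF k)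
  have hI1 : ∀ k, Integrable (fun x => f k x * partialDeriv k ψ x) := fun k =>
    ((hψ.partialDeriv k).smul_smooth (hfs k)).integrable
  have hI2 : ∀ k, Integrable (fun x => partialDeriv k (f k) x * ψ x) := fun k =>
    (hψ.smul_smooth ((hfs k).partialDeriv k)).integrable
  have hI3 : ∀ k, Integrable (fun x => 2 * (F k x * η x) ^ 2 +
      3 * (h x * partialDeriv k η x) ^ 2) := fun k => by
    have e : (fun x => 2 * (F k x * η x) ^ 2 + 3 * (h x * partialDeriv k η x) ^ 2) =
        fun x => (2 * F k x * η x * F k x) * η x +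
          (3 * h x * partialDeriv k η x * h x) * partialDeriv k η x := by
      ext x; ring
    rw [e]
    refine ((hη.smul_smooth ?_).add ((hη.partialDeriv k).smul_smooth ?_)).integrable
    · exact (((contDiff_const.mul (hF k)).mul hη.contDiff).mul (hF k))
    · exact ((contDiff_const.mul hh).mul (hη.partialDeriv k).contDiff).mul hh
  have hI4 : ∀ k, Integrable (fun x => partialDeriv k (fun y => h y * η y) x ^ 2) := fun k => by
    simp only [pow_two]
    exact ((hu.partialDeriv k).smul_smooth (hu.partialDeriv k).contDiff).integrable
  have hzero : ∑ k, ∫ x, f k x * partialDeriv k ψ x = 0 := by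
    have e : ∀ k, ∫ x, f k x * partialDeriv k ψ x = - ∫ x, partialDeriv k (f k) x * ψ x :=
      fun k => integral_mul_partialDeriv (hfs k) hψ k
    rw [Finset.sum_congr rfl fun k _ => e k, Finset.sum_neg_distrib,
      ← integral_finsetSum _ fun k _ => hI2 k]
    simp only [← Finset.sum_mul]
    rw [neg_eq_zero]
    refine integral_eq_zero_of_ae (Eventually.of_forall fun x => ?_)
    by_cases hx : x ∈ tsupport η
    · have := heq x hx
      rw [← Finset.sum_add_distrib] at this
      simp only [hf, partialDeriv_add (hh.partialDeriv _) (hF _), this, zero_mul, Pi.zero_apply]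
    · simp [ψ, image_eq_zero_of_notMem_tsupport hx]
  calc ∫ x, ∑ k, partialDeriv k (fun y => h y * η y) x ^ 2
      ≤ ∫ x, ∑ k, (2 * (f k x * partialDeriv k ψ x) +
          (2 * (F k x * η x) ^ 2 + 3 * (h x * partialDeriv k η x) ^ 2)) := by
        refine integral_mono (integrable_finsetSum _ fun k _ => hI4 k)
          (integrable_finsetSum _ fun k _ => ((hI1 k).const_mul 2).add (hI3 k)) fun x => ?_
        refine Finset.sum_le_sum fun k _ => ?_
        simp only [ψ, hf, partialDeriv_mul hη.contDiff hu.contDiff, partialDeriv_mul hh hη.contDiff]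
        -- The difference of the two sides is the sum of the squares below.
        nlinarith [sq_nonneg (partialDeriv k h x * η x + h x * partialDeriv k η x + F k x * η x),
          sq_nonneg (F k x * η x + h x * partialDeriv k η x)]
    _ = _ := by
        simp only [Finset.sum_add_distrib]
        simp only [← Finset.mul_sum]
        rw [integral_add, integral_const_mul, integral_finsetSum _ fun k _ => hI1 k, hzero]
        · simp
        · exact (integrable_finsetSum _ fun k _ => hI1 k).const_mul 2
        · have := integrable_finsetSum Finset.univ fun k _ => hI3 k
          simpa only [Finset.sum_add_distrib, ← Finset.mul_sum] using this

/-- The interior energy estimate in `L²` norms. The factor depends on the cutoff only. -/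
theorem exists_eLpNorm_partialDeriv_le {Ω U : Set Plane} {η : Plane → ℝ} (hη : IsTestFunction ⊤ Ω η)
    (hU : MeasurableSet U) (hηU : ∀ x ∈ U, η =ᶠ[𝓝 x] 1) :
    ∃ C : ENNReal, C ≠ ⊤ ∧ ∀ (h : Plane → ℝ) (F : Fin 2 → Plane → ℝ), ContDiff ℝ ∞ h →
      (∀ k, ContDiff ℝ ∞ (F k)) →
      (∀ x ∈ tsupport η,
        ∑ k, partialDeriv k (partialDeriv k h) x + ∑ k, partialDeriv k (F k) x = 0) →
      ∀ i, eLpNorm (partialDeriv i h) 2 (volume.restrict U) ^ (2 : ℝ) ≤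
        C * (eLpNorm h 2 (volume.restrict (tsupport η)) ^ (2 : ℝ) +
          ∑ k, eLpNorm (F k) 2 (volume.restrict (tsupport η)) ^ (2 : ℝ)) := by
  obtain ⟨M, hM⟩ : ∃ M : ℝ, ∀ x, η x ^ 2 ≤ M ∧ ∀ k, partialDeriv k η x ^ 2 ≤ M := by
    have hb : ∀ {φ : Plane → ℝ}, IsTestFunction ⊤ Ω φ → ∃ C : ℝ, ∀ x, φ x ^ 2 ≤ C := by
      intro φ hφ
      obtain ⟨C, hC⟩ := hφ.continuous.bounded_above_of_compact_support hφ.2.1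
      refine ⟨C ^ 2, fun x => ?_⟩
      rw [← sq_abs]
      exact pow_le_pow_left₀ (abs_nonneg _) (hC x) 2
    obtain ⟨C, hC⟩ := hb hη
    choose D hD using fun k => hb (hη.partialDeriv k)
    refine ⟨max C (max (D 0) (D 1)), fun x => ⟨(hC x).trans (le_max_left _ _), fun k => ?_⟩⟩
    refine (hD k x).trans ?_
    fin_cases k <;> simp
  have hM0 : 0 ≤ M := (sq_nonneg _).trans (hM 0).1
  refine ⟨ENNReal.ofReal (6 * M), ENNReal.ofReal_ne_top, fun h F hh hF heq i => ?_⟩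
  have hmain := integral_sq_partialDeriv_mul_cutoff_le hh hF hη heq
  have hu : IsTestFunction ⊤ Ω (fun y => h y * η y) := hη.smul_smooth hh
  set G : Plane → ℝ := fun x => ∑ k, (2 * (F k x * η x) ^ 2 + 3 * (h x * partialDeriv k η x) ^ 2)
    with hG
  have hG0 : ∀ x, 0 ≤ G x := fun x => Finset.sum_nonneg fun k _ => by positivity
  have hGs : ∀ x, x ∉ tsupport η → G x = 0 := fun x hx => by
    have h1 := image_eq_zero_of_notMem_tsupport hx
    have h2 : ∀ k, partialDeriv k η x = 0 := fun k =>
      image_eq_zero_of_notMem_tsupport fun h => hx (tsupport_partialDeriv_subset k η h)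
    simp [hG, h1, h2]
  have hGc : Continuous G := by
    refine continuous_finsetSum _ fun k _ => ?_
    have := (hF k).continuous
    have := hη.continuous
    have := hh.continuous
    have := (hη.partialDeriv k).continuous
    fun_prop
  have hGi : Integrable G := hGc.integrable_of_hasCompactSupport
    (HasCompactSupport.of_support_subset_isCompact hη.2.1 fun x hx => by
      by_contra hx'
      exact hx (hGs x hx'))
  have hI : ∀ k, Integrable (fun x => partialDeriv k (fun y => h y * η y) x ^ 2) := fun k => by
    simp only [pow_two]
    exact ((hu.partialDeriv k).smul_smooth (hu.partialDeriv k).contDiff).integrable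
  have hmeas : MeasurableSet (tsupport η) := (isClosed_tsupport η).measurableSet
  simp only [eLpNorm_two_rpow_two]
  calc ∫⁻ x in U, ENNReal.ofReal (partialDeriv i h x ^ 2)
      = ∫⁻ x in U, ENNReal.ofReal (partialDeriv i (fun y => h y * η y) x ^ 2) := by
        refine setLIntegral_congr_fun hU fun x hx => ?_
        have e : (fun y => h y * η y) =ᶠ[𝓝 x] h := by
          filter_upwards [hηU x hx] with y hy
          simp [hy]
        simp only [partialDeriv, e.fderiv_eq]
    _ ≤ ∫⁻ x, ENNReal.ofReal (partialDeriv i (fun y => h y * η y) x ^ 2) :=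
        setLIntegral_le_lintegral _ _
    _ = ENNReal.ofReal (∫ x, partialDeriv i (fun y => h y * η y) x ^ 2) :=
        (ofReal_integral_eq_lintegral_ofReal (hI i)
          (Eventually.of_forall fun x => sq_nonneg _)).symm
    _ ≤ ENNReal.ofReal (∫ x, G x) := by
        refine ENNReal.ofReal_le_ofReal (le_trans ?_ hmain)
        refine integral_mono (hI i) (integrable_finsetSum _ fun k _ => hI k) fun x => ?_
        exact Finset.single_le_sum (f := fun k => partialDeriv k (fun y => h y * η y) x ^ 2)
          (fun k _ => sq_nonneg _) (Finset.mem_univ i)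
    _ = ∫⁻ x, ENNReal.ofReal (G x) :=
        ofReal_integral_eq_lintegral_ofReal hGi (Eventually.of_forall hG0)
    _ = ∫⁻ x in tsupport η, ENNReal.ofReal (G x) := by
        rw [← lintegral_indicator hmeas]
        refine lintegral_congr fun x => ?_
        by_cases hx : x ∈ tsupport η
        · simp [hx]
        · simp [hx, hGs x hx]
    _ ≤ ∫⁻ x in tsupport η, ENNReal.ofReal (6 * M) *
          (ENNReal.ofReal (h x ^ 2) + ∑ k, ENNReal.ofReal (F k x ^ 2)) := by
        refine lintegral_mono fun x => ?_
        simp only []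
        rw [← ENNReal.ofReal_sum_of_nonneg fun k _ => sq_nonneg _,
          ← ENNReal.ofReal_add (sq_nonneg _) (Finset.sum_nonneg fun k _ => sq_nonneg _),
          ← ENNReal.ofReal_mul (by positivity)]
        refine ENNReal.ofReal_le_ofReal ?_
        obtain ⟨h1, h2⟩ := hM x
        simp only [hG, Fin.sum_univ_two, mul_pow]
        nlinarith [mul_le_mul_of_nonneg_left h1 (sq_nonneg (F 0 x)),
          mul_le_mul_of_nonneg_left h1 (sq_nonneg (F 1 x)),
          mul_le_mul_of_nonneg_left (h2 0) (sq_nonneg (h x)),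
          mul_le_mul_of_nonneg_left (h2 1) (sq_nonneg (h x)),
          mul_nonneg hM0 (sq_nonneg (F 0 x)), mul_nonneg hM0 (sq_nonneg (F 1 x))]
    _ = _ := by
        have hFm : ∀ k, Measurable fun x => ENNReal.ofReal (F k x ^ 2) := fun k =>
          ((hF k).continuous.pow 2).measurable.ennreal_ofReal
        have hhm : Measurable fun x => ENNReal.ofReal (h x ^ 2) :=
          (hh.continuous.pow 2).measurable.ennreal_ofReal
        have hsm : Measurable fun x => ENNReal.ofReal (h x ^ 2) +
            ∑ k, ENNReal.ofReal (F k x ^ 2) := by fun_prop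
        rw [lintegral_const_mul _ hsm, lintegral_add_left hhm,
          lintegral_finsetSum _ fun k _ => hFm k]

/-! ### Interior regularity for the Poisson equation -/

/-- Both derivatives fall on the translated kernel, which for `x` inside `Ω` and large `n` is a
test function on `Ω`; so a weak equation for `h` becomes a pointwise one for its mollification. -/
theorem partialDeriv_sq_mollify {Ω : Set Plane} (hΩ : IsOpen Ω) {h : Plane → ℝ}
    (hh : MemLp h 2 (volume.restrict Ω)) {n : ℕ} {x : Plane}
    (hx : IsTestFunction ⊤ Ω (fun y => mollifier n (x - y))) (k : Fin 2) :
    partialDeriv k (partialDeriv k (mollify Ω n h)) x =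
      ∫ y, h y * partialDeriv k (partialDeriv k fun y => mollifier n (x - y)) y := by
  have hl : LocallyIntegrable (Ω.indicator h) :=
    (hh.indicator_restrict hΩ).locallyIntegrable (by norm_num)
  have hs1 : partialDeriv k (fun y => mollifier n (x - y)) =
      fun y => (-1 : ℝ) * partialDeriv k (mollifier n) (x - y) := by
    ext y; rw [partialDeriv_comp_sub_left (contDiff_mollifier n)]; ring
  have hs2 : partialDeriv k (partialDeriv k fun y => mollifier n (x - y)) =
      fun y => partialDeriv k (partialDeriv k (mollifier n)) (x - y) := by
    ext y
    have hsm : ContDiff ℝ ∞ fun y => partialDeriv k (mollifier n) (x - y) :=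
      ((contDiff_mollifier n).partialDeriv k).comp (contDiff_const.sub contDiff_id)
    rw [hs1, partialDeriv_mul contDiff_const hsm,
      partialDeriv_comp_sub_left ((contDiff_mollifier n).partialDeriv k)]
    simp [partialDeriv]
  have ht := (hx.partialDeriv k).partialDeriv k
  rw [hs2] at ht ⊢
  unfold mollify
  rw [partialDeriv_conv (contDiff_mollifier n) (hasCompactSupport_mollifier n) hl,
    partialDeriv_conv ((contDiff_mollifier n).partialDeriv k)
      ((hasCompactSupport_mollifier n).partialDeriv k) hl, conv_indicator ht]

theorem partialDeriv_mollify_eq_neg {Ω : Set Plane} (hΩ : IsOpen Ω) {f : Plane → ℝ}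
    (hf : MemLp f 2 (volume.restrict Ω)) {n : ℕ} {x : Plane}
    (hx : IsTestFunction ⊤ Ω (fun y => mollifier n (x - y))) (k : Fin 2) :
    partialDeriv k (mollify Ω n f) x =
      - ∫ y, f y * partialDeriv k (fun y => mollifier n (x - y)) y := by
  have hl : LocallyIntegrable (Ω.indicator f) :=
    (hf.indicator_restrict hΩ).locallyIntegrable (by norm_num)
  have hs1 : partialDeriv k (fun y => mollifier n (x - y)) =
      fun y => - partialDeriv k (mollifier n) (x - y) := by
    ext y; rw [partialDeriv_comp_sub_left (contDiff_mollifier n)]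
  have ht : IsTestFunction ⊤ Ω (fun y => partialDeriv k (mollifier n) (x - y)) := by
    have h := (hx.partialDeriv k).smul_smooth (contDiff_const (c := (-1 : ℝ)))
    simpa [hs1] using h
  rw [hs1]
  unfold mollify
  rw [partialDeriv_conv (contDiff_mollifier n) (hasCompactSupport_mollifier n) hl,
    conv_indicator ht]
  simp [integral_neg]

theorem tendsto_eLpNorm_mollify_sub_mollify {Ω : Set Plane} (hΩ : IsOpen Ω) {f : Plane → ℝ}
    (hf : MemLp f 2 (volume.restrict Ω)) {K : Set Plane} (hK : K ⊆ Ω) :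
    Tendsto (fun q : ℕ × ℕ => eLpNorm (mollify Ω q.1 f - mollify Ω q.2 f) 2 (volume.restrict K))
      atTop (𝓝 0) :=
  tendsto_eLpNorm_sub_prod (a := fun n => mollify Ω n f) (b := f)
    (fun n => (contDiff_mollify hΩ hf n).continuous.aestronglyMeasurable)
    (hf.mono_set hK).1 (tendsto_eLpNorm_mono_set hK (tendsto_eLpNorm_mollify_sub hΩ hf))

/-- Interior regularity for the Poisson equation in divergence form: an `L²` solution of
`Δh = - div F` with `F ∈ L²` has weak first derivatives in `L²_loc`. -/
theorem exists_weakDeriv_of_laplacian_eq_div {Ω U : Set Plane} (hΩ : IsOpen Ω) (hU : IsOpen U)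
    (hUc : IsCompact (closure U)) (hUΩ : closure U ⊆ Ω) {h : Plane → ℝ} {F : Fin 2 → Plane → ℝ}
    (hh : MemLp h 2 (volume.restrict Ω)) (hF : ∀ k, MemLp (F k) 2 (volume.restrict Ω))
    (heq : ∀ φ, IsTestFunction ⊤ Ω φ →
      ∑ k, ∫ x, h x * partialDeriv k (partialDeriv k φ) x =
        ∑ k, ∫ x, F k x * partialDeriv k φ x) (i : Fin 2) :
    ∃ g, MemLp g 2 (volume.restrict U) ∧ HasWeakPartialDeriv U i h g := by
  obtain ⟨η, hη, hη1⟩ := exists_cutoff hΩ hUc hUΩ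
  have hηU : ∀ x ∈ U, η =ᶠ[𝓝 x] 1 := fun x hx =>
    eventually_nhdsSet_iff_forall.1 hη1 x (subset_closure hx)
  obtain ⟨C, hC, hest⟩ := exists_eLpNorm_partialDeriv_le hη hU.measurableSet hηU
  have hUΩ' : U ⊆ Ω := subset_closure.trans hUΩ
  have hsm : ∀ n, ContDiff ℝ ∞ (mollify Ω n h) := contDiff_mollify hΩ hh
  have hsmF : ∀ k n, ContDiff ℝ ∞ (mollify Ω n (F k)) := fun k => contDiff_mollify hΩ (hF k)
  have hml : ∀ n, MemLp (partialDeriv i (mollify Ω n h)) 2 (volume.restrict U) := fun n =>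
    ((hsm n).partialDeriv i).continuous.memLp_restrict_compact hUc subset_closure 2
  obtain ⟨N, hN⟩ := eventually_atTop.1 (eventually_isTestFunction_translate hΩ hη.2.1 hη.2.2)
  -- The mollified functions solve the equation near the support of the cutoff.
  have hmeq : ∀ n ≥ N, ∀ x ∈ tsupport η,
      ∑ k, partialDeriv k (partialDeriv k (mollify Ω n h)) x +
        ∑ k, partialDeriv k (mollify Ω n (F k)) x = 0 := by
    intro n hn x hx
    have ht := hN n hn x hx
    simp only [partialDeriv_sq_mollify hΩ hh ht, partialDeriv_mollify_eq_neg hΩ (hF _) ht]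
    rw [heq _ ht, Finset.sum_neg_distrib, add_neg_cancel]
  have hcauchy : Tendsto (fun q : ℕ × ℕ => eLpNorm (partialDeriv i (mollify Ω q.1 h) -
      partialDeriv i (mollify Ω q.2 h)) 2 (volume.restrict U)) atTop (𝓝 0) := by
    have hz : Tendsto (fun q : ℕ × ℕ => C *
        (eLpNorm (mollify Ω q.1 h - mollify Ω q.2 h) 2 (volume.restrict (tsupport η)) ^ (2 : ℝ) +
          ∑ k, eLpNorm (mollify Ω q.1 (F k) - mollify Ω q.2 (F k)) 2
            (volume.restrict (tsupport η)) ^ (2 : ℝ))) atTop (𝓝 0) := by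
      have hp : ∀ {u : ℕ × ℕ → ENNReal}, Tendsto u atTop (𝓝 0) →
          Tendsto (fun q => u q ^ (2 : ℝ)) atTop (𝓝 0) := fun hu => by
        have := (ENNReal.continuous_rpow_const (y := (2 : ℝ))).tendsto 0 |>.comp hu
        simpa [Function.comp_def] using this
      have h1 := hp (tendsto_eLpNorm_mollify_sub_mollify hΩ hh hη.2.2)
      have h2 := tendsto_finsetSum Finset.univ fun k (_ : k ∈ Finset.univ) =>
        hp (tendsto_eLpNorm_mollify_sub_mollify hΩ (hF k) hη.2.2)
      have h3 := ENNReal.Tendsto.const_mul (h1.add h2) (Or.inr hC)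
      simpa using h3
    have hsq : Tendsto (fun q : ℕ × ℕ => eLpNorm (partialDeriv i (mollify Ω q.1 h) -
        partialDeriv i (mollify Ω q.2 h)) 2 (volume.restrict U) ^ (2 : ℝ)) atTop (𝓝 0) := by
      refine tendsto_of_tendsto_of_tendsto_of_le_of_le' tendsto_const_nhds hz
        (Eventually.of_forall fun _ => zero_le) ?_
      filter_upwards [eventually_ge_atTop (N, N)] with q hq
      have hd : ∀ {a b : Plane → ℝ}, ContDiff ℝ ∞ a → ContDiff ℝ ∞ b → ∀ k,
          partialDeriv k (a - b) = partialDeriv k a - partialDeriv k b := fun ha hb k => by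
        ext x; exact partialDeriv_sub ha hb k x
      have h1 := hest (mollify Ω q.1 h - mollify Ω q.2 h)
        (fun k => mollify Ω q.1 (F k) - mollify Ω q.2 (F k)) ((hsm _).sub (hsm _))
        (fun k => (hsmF k _).sub (hsmF k _)) ?_ i
      · rwa [hd (hsm _) (hsm _)] at h1
      · intro x hx
        simp only [hd (hsm _) (hsm _), hd (hsmF _ _) (hsmF _ _),
          hd ((hsm _).partialDeriv _) ((hsm _).partialDeriv _), Pi.sub_apply,
          Finset.sum_sub_distrib]
        linarith [hmeq q.1 hq.1 x hx, hmeq q.2 hq.2 x hx]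
    have := (ENNReal.continuous_rpow_const (y := (1 / 2 : ℝ))).tendsto 0 |>.comp hsq
    refine (this.congr fun q => ?_).trans_eq ?_
    · simp only [Function.comp_apply]
      rw [← ENNReal.rpow_mul]
      norm_num
    · norm_num
  obtain ⟨g, hg, hgl⟩ := exists_memLp_tendsto_of_cauchy hml hcauchy
  refine ⟨g, hg, HasWeakPartialDeriv.of_tendsto (Eventually.of_forall fun n =>
    (hsm n).continuous.memLp_restrict_compact hUc subset_closure 2) (Eventually.of_forall hml)
    (hh.mono_set hUΩ') hg (Eventually.of_forall fun n => .of_smooth (hsm n) i)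
    (tendsto_eLpNorm_mono_set hUΩ' (tendsto_eLpNorm_mollify_sub hΩ hh)) hgl⟩

/-! ### The Sobolev embedding and the product rule -/

theorem eLpNorm_mollify_le {Ω : Set Plane} (hΩ : IsOpen Ω) {f : Plane → ℝ}
    (hf : MemLp f 2 (volume.restrict Ω)) (n : ℕ) :
    eLpNorm (mollify Ω n f) 2 volume ≤ eLpNorm f 2 (volume.restrict Ω) := by
  rw [← eLpNorm_indicator_eq_eLpNorm_restrict hΩ.measurableSet]
  exact eLpNorm_conv_mollifier_le (hf.indicator_restrict hΩ).1 n

theorem memLp_mollify {Ω : Set Plane} (hΩ : IsOpen Ω) {f : Plane → ℝ}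
    (hf : MemLp f 2 (volume.restrict Ω)) (n : ℕ) (U : Set Plane) :
    MemLp (mollify Ω n f) 2 (volume.restrict U) :=
  MemLp.restrict U ⟨(contDiff_mollify hΩ hf n).continuous.aestronglyMeasurable,
    (eLpNorm_mollify_le hΩ hf n).trans_lt hf.2⟩

theorem ae_tendsto_mollify {Ω : Set Plane} (hΩ : IsOpen Ω) {f : Plane → ℝ}
    (hf : MemLp f 2 (volume.restrict Ω)) :
    ∀ᵐ x ∂volume.restrict Ω, Tendsto (fun n => mollify Ω n f x) atTop (𝓝 (f x)) := by
  have h := ContDiffBump.ae_convolution_tendsto_right_of_locallyIntegrable (K := 2)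
    tendsto_mollifierBump_rOut (Eventually.of_forall fun n => by
      simp only [mollifierBump]; linarith)
    ((hf.indicator_restrict hΩ).locallyIntegrable (by norm_num))
  rw [ae_restrict_iff' hΩ.measurableSet]
  filter_upwards [h] with x hx hxΩ
  rw [Set.indicator_of_mem hxΩ] at hx
  exact hx

theorem norm_fderiv_le_sum_partialDeriv (f : Plane → ℝ) (x : Plane) :
    ‖fderiv ℝ f x‖ ≤ ‖partialDeriv 0 f x‖ + ‖partialDeriv 1 f x‖ := by
  refine ContinuousLinearMap.opNorm_le_bound _ (by positivity) fun y => ?_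
  have hy : y = y 0 • EuclideanSpace.single 0 1 + y 1 • EuclideanSpace.single 1 1 := by
    ext i
    fin_cases i <;> simp
  have h0 := PiLp.norm_apply_le y 0
  have h1 := PiLp.norm_apply_le y 1
  conv_lhs => rw [hy, map_add, map_smul, map_smul]
  refine (norm_add_le _ _).trans ?_
  rw [norm_smul, norm_smul, add_mul, mul_comm ‖y 0‖, mul_comm ‖y 1‖]
  exact add_le_add (mul_le_mul_of_nonneg_left h0 (norm_nonneg _))
    (mul_le_mul_of_nonneg_left h1 (norm_nonneg _))

/-- The Gagliardo–Nirenberg–Sobolev inequality `‖u‖₆ ≤ C ‖Du‖_{3/2} ≤ C' ‖Du‖₂` in the plane, for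
`u` supported in a fixed bounded set. -/
theorem exists_eLpNorm_six_le {K : Set Plane} (hK : IsCompact K) :
    ∃ C : ENNReal, C ≠ ⊤ ∧ ∀ u : Plane → ℝ, ContDiff ℝ ∞ u → tsupport u ⊆ K →
      eLpNorm u 6 volume ≤
        C * (eLpNorm (partialDeriv 0 u) 2 volume + eLpNorm (partialDeriv 1 u) 2 volume) := by
  set D : NNReal := eLpNormLESNormFDerivOfLeConst ℝ (volume : Measure Plane) K (3 / 2) 6
  set m : ENNReal := volume K ^ (1 / ((3 / 2 : NNReal) : ENNReal).toReal - 1 / (2 : ENNReal).toReal)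
    with hm
  refine ⟨D * m, ENNReal.mul_ne_top ENNReal.coe_ne_top
    (ENNReal.rpow_ne_top_of_nonneg ?_ hK.measure_lt_top.ne), fun u hu huK => ?_⟩
  · norm_num
  have hgns := eLpNorm_le_eLpNorm_fderiv_of_le (volume : Measure Plane) (hu.of_le (by simp))
    ((subset_tsupport u).trans huK) (p := 3 / 2) (q := 6) (by
      rw [le_div_iff₀ (by norm_num)]; norm_num) (by
      simp only [finrank_euclideanSpace, Fintype.card_fin]
      rw [div_lt_iff₀ (by norm_num)]; norm_num) (by
      simp only [finrank_euclideanSpace, Fintype.card_fin]; norm_num) hK.isBounded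
  have hcp : ∀ i, AEStronglyMeasurable (partialDeriv i u) volume := fun i =>
    (hu.partialDeriv i).continuous.aestronglyMeasurable
  have hH : ∀ i, eLpNorm (partialDeriv i u) ((3 / 2 : NNReal) : ENNReal) volume ≤
      eLpNorm (partialDeriv i u) 2 volume * m := fun i => by
    have hs : Function.support (partialDeriv i u) ⊆ K :=
      (subset_tsupport _).trans ((tsupport_partialDeriv_subset i u).trans huK)
    rw [← eLpNorm_restrict_eq_of_support_subset (p := ((3 / 2 : NNReal) : ENNReal)) hs,
      ← eLpNorm_restrict_eq_of_support_subset (p := 2) hs]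
    have h32 : ((3 / 2 : NNReal) : ENNReal) ≤ 2 := by
      have : (3 / 2 : NNReal) ≤ 2 := by rw [div_le_iff₀ (by norm_num)]; norm_num
      exact_mod_cast this
    have := eLpNorm_le_eLpNorm_mul_rpow_measure_univ h32 (hcp i).restrict (μ := volume.restrict K)
    rwa [Measure.restrict_apply_univ] at this
  have h1 : (1 : ENNReal) ≤ ((3 / 2 : NNReal) : ENNReal) := by
    have : (1 : NNReal) ≤ 3 / 2 := by rw [le_div_iff₀ (by norm_num)]; norm_num
    exact_mod_cast this
  have hf : eLpNorm (fderiv ℝ u) ((3 / 2 : NNReal) : ENNReal) volume ≤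
      eLpNorm (partialDeriv 0 u) ((3 / 2 : NNReal) : ENNReal) volume +
        eLpNorm (partialDeriv 1 u) ((3 / 2 : NNReal) : ENNReal) volume := by
    rw [← eLpNorm_norm (partialDeriv 0 u), ← eLpNorm_norm (partialDeriv 1 u)]
    refine le_trans ?_ (eLpNorm_add_le (hcp 0).norm (hcp 1).norm h1)
    exact eLpNorm_mono_real fun x => norm_fderiv_le_sum_partialDeriv u x
  calc eLpNorm u 6 volume ≤ D * eLpNorm (fderiv ℝ u) ((3 / 2 : NNReal) : ENNReal) volume := hgns
    _ ≤ D * (eLpNorm (partialDeriv 0 u) 2 volume * m + eLpNorm (partialDeriv 1 u) 2 volume * m) :=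
        mul_le_mul_right (hf.trans (add_le_add (hH 0) (hH 1))) _
    _ = _ := by ring

theorem IsTestFunction.exists_eLpNorm_mul_le {Ω : Set Plane} {η : Plane → ℝ}
    (hη : IsTestFunction ⊤ Ω η) :
    ∃ M : ENNReal, M ≠ ⊤ ∧ ∀ f : Plane → ℝ,
      eLpNorm (fun x => f x * η x) 2 volume ≤ M * eLpNorm f 2 volume := by
  obtain ⟨C, hC⟩ := hη.continuous.bounded_above_of_compact_support hη.2.1
  refine ⟨ENNReal.ofReal C, ENNReal.ofReal_ne_top, fun f => ?_⟩
  refine eLpNorm_le_mul_eLpNorm_of_ae_le_mul (Eventually.of_forall fun x => ?_) 2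
  rw [norm_mul, mul_comm]
  exact mul_le_mul_of_nonneg_right (hC x) (norm_nonneg _)

/-- Functions in `W^{1,2}` of a planar open set are locally in `L⁶`. -/
theorem memLp_six_of_hasWeakPartialDeriv {Ω K : Set Plane} (hΩ : IsOpen Ω) (hK : IsCompact K)
    (hKΩ : K ⊆ Ω) {f : Plane → ℝ} {g : Fin 2 → Plane → ℝ} (hf : MemLp f 2 (volume.restrict Ω))
    (hg : ∀ i, MemLp (g i) 2 (volume.restrict Ω)) (hfg : ∀ i, HasWeakPartialDeriv Ω i f (g i)) :
    MemLp f 6 (volume.restrict K) := by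
  obtain ⟨η, hη, hη1⟩ := exists_cutoff hΩ hK hKΩ
  obtain ⟨C, hC, hCu⟩ := exists_eLpNorm_six_le hη.2.1
  obtain ⟨M, hM, hMf⟩ := hη.exists_eLpNorm_mul_le
  choose M' hM' hMf' using fun i => (hη.partialDeriv i).exists_eLpNorm_mul_le
  set B : Fin 2 → ENNReal := fun i => M * eLpNorm (g i) 2 (volume.restrict Ω) +
    M' i * eLpNorm f 2 (volume.restrict Ω) with hB
  have hBt : ∀ i, B i ≠ ⊤ := fun i => ENNReal.add_ne_top.2
    ⟨ENNReal.mul_ne_top hM (hg i).2.ne, ENNReal.mul_ne_top (hM' i) hf.2.ne⟩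
  have hsm := fun n => contDiff_mollify hΩ hf n
  have hbound : ∀ᶠ n in atTop,
      eLpNorm (mollify Ω n f) 6 (volume.restrict K) ≤ C * (B 0 + B 1) := by
    filter_upwards [eventually_isTestFunction_translate hΩ hη.2.1 hη.2.2] with n hn
    have hp : ∀ i, eLpNorm (partialDeriv i fun x => mollify Ω n f x * η x) 2 volume ≤ B i := by
      intro i
      have e : (partialDeriv i fun x => mollify Ω n f x * η x) =
          (fun x => mollify Ω n (g i) x * η x) + fun x => mollify Ω n f x * partialDeriv i η x := by
        ext x
        rw [partialDeriv_mul (hsm n) hη.contDiff, Pi.add_apply]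
        congr 1
        by_cases hx : x ∈ tsupport η
        · rw [partialDeriv_mollify hΩ hf (hfg i) (hn x hx)]
        · rw [image_eq_zero_of_notMem_tsupport hx, mul_zero, mul_zero]
      rw [e]
      refine (eLpNorm_add_le (Continuous.aestronglyMeasurable ?_)
        (Continuous.aestronglyMeasurable ?_) (by norm_num)).trans (add_le_add ?_ ?_)
      · exact (contDiff_mollify hΩ (hg i) n).continuous.mul hη.continuous
      · exact (hsm n).continuous.mul (hη.partialDeriv i).continuous
      · exact (hMf _).trans (mul_le_mul_right (eLpNorm_mollify_le hΩ (hg i) n) _)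
      · exact (hMf' i _).trans (mul_le_mul_right (eLpNorm_mollify_le hΩ hf n) _)
    calc eLpNorm (mollify Ω n f) 6 (volume.restrict K)
        = eLpNorm (fun x => mollify Ω n f x * η x) 6 (volume.restrict K) := by
          refine eLpNorm_congr_ae ((ae_restrict_iff' hK.measurableSet).2
            (Eventually.of_forall fun x hx => ?_))
          simp [hη1.self_of_nhdsSet x hx]
      _ ≤ eLpNorm (fun x => mollify Ω n f x * η x) 6 volume :=
          eLpNorm_mono_measure _ Measure.restrict_le_self
      _ ≤ _ := hCu _ ((hsm n).mul hη.contDiff) tsupport_mul_subset_right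
      _ ≤ _ := mul_le_mul_right (add_le_add (hp 0) (hp 1)) _
  refine ⟨(hf.mono_set hKΩ).1, ?_⟩
  refine (Lp.eLpNorm_lim_le_liminf_eLpNorm
    (fun n => (hsm n).continuous.aestronglyMeasurable) f
    (ae_mono (Measure.restrict_mono hKΩ le_rfl) (ae_tendsto_mollify hΩ hf))).trans_lt ?_
  refine lt_of_le_of_lt (liminf_le_of_frequently_le' hbound.frequently) ?_
  exact (ENNReal.mul_ne_top hC (ENNReal.add_ne_top.2 ⟨hBt 0, hBt 1⟩)).lt_top

/-- The product rule in `W^{1,2}`: approximate the first factor by smooth functions. -/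
theorem HasWeakPartialDeriv.mul {Ω : Set Plane} (hΩ : IsOpen Ω) {i : Fin 2}
    {f f' h h' : Plane → ℝ} (hf : MemLp f 2 (volume.restrict Ω))
    (hf' : MemLp f' 2 (volume.restrict Ω)) (hh : MemLp h 2 (volume.restrict Ω))
    (hh' : MemLp h' 2 (volume.restrict Ω)) (hff' : HasWeakPartialDeriv Ω i f f')
    (hhh' : HasWeakPartialDeriv Ω i h h') :
    HasWeakPartialDeriv Ω i (fun x => f x * h x) (fun x => f' x * h x + f x * h' x) := by
  have hI1 : IntegrableOn (fun x => f x * h x) Ω := hf.integrable_mul hh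
  have hI2 : IntegrableOn (fun x => f' x * h x + f x * h' x) Ω :=
    (hf'.integrable_mul hh).add (hf.integrable_mul hh')
  refine ⟨hI1.locallyIntegrableOn, hI2.locallyIntegrableOn, fun φ hφ => ?_⟩
  have hb : ∀ {u ψ : Plane → ℝ}, MemLp u 2 (volume.restrict Ω) → IsTestFunction ⊤ Ω ψ →
      MemLp (fun x => u x * ψ x) 2 (volume.restrict Ω) := fun hu hψ =>
    MemLp.mul' (p := 2) (q := ⊤) (hψ.memLp ⊤ Ω) hu
  have hJ : ∀ {u c : Plane → ℝ}, MemLp u 2 (volume.restrict Ω) → MemLp c 2 (volume.restrict Ω) →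
      Integrable (fun x => u x * c x) (volume.restrict Ω) := fun hu hc => hu.integrable_mul hc
  have T : ∀ {u c : Plane → ℝ}, MemLp u 2 (volume.restrict Ω) → MemLp c 2 (volume.restrict Ω) →
      Tendsto (fun n => ∫ x in Ω, mollify Ω n u x * c x) atTop (𝓝 (∫ x in Ω, u x * c x)) :=
    fun hu hc => tendsto_integral_mul_of_tendsto_eLpNorm
      (Eventually.of_forall fun n => memLp_mollify hΩ hu n Ω) hu hc
      (tendsto_eLpNorm_mollify_sub hΩ hu)
  have c1 := hb hh (hφ.partialDeriv i)
  have c2 := hb hh hφ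
  have c3 := hb hh' hφ
  have hlim := tendsto_nhds_unique_of_eventuallyEq ((T hf c1).add (T hf' c2)) (T hf c3).neg ?_
  · have e1 : ∀ x, f x * h x * partialDeriv i φ x = f x * (h x * partialDeriv i φ x) :=
      fun x => by ring
    have e2 : ∀ x, (f' x * h x + f x * h' x) * φ x = f' x * (h x * φ x) + f x * (h' x * φ x) :=
      fun x => by ring
    simp only [e1, e2]
    rw [integral_add (hJ hf' c2) (hJ hf c3)]
    linarith
  · filter_upwards [eventually_isTestFunction_translate hΩ hφ.2.1 hφ.2.2] with n hn
    have ht : IsTestFunction ⊤ Ω (fun x => mollify Ω n f x * φ x) :=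
      hφ.smul_smooth (contDiff_mollify hΩ hf n)
    have h1 := hhh'.2.2 _ ht
    rw [← integral_add (hJ (memLp_mollify hΩ hf n Ω) c1) (hJ (memLp_mollify hΩ hf' n Ω) c2)]
    have e1 : ∀ x, h x * partialDeriv i (fun x => mollify Ω n f x * φ x) x =
        mollify Ω n f x * (h x * partialDeriv i φ x) + mollify Ω n f' x * (h x * φ x) := by
      intro x
      rw [partialDeriv_mul (contDiff_mollify hΩ hf n) hφ.contDiff]
      by_cases hx : x ∈ tsupport φ
      · rw [partialDeriv_mollify hΩ hf hff' (hn x hx)]; ring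
      · rw [image_eq_zero_of_notMem_tsupport hx]; ring
    have e2 : ∀ x, h' x * (mollify Ω n f x * φ x) = mollify Ω n f x * (h' x * φ x) :=
      fun x => by ring
    simp only [e1, e2] at h1
    exact h1

/-! ### Sobolev functions and weak solutions -/

namespace MemW2

variable {k : ℕ} {Ω U : Set Plane} {f f' : Plane → ℝ}

theorem memLp (h : MemW2 k Ω f) : MemLp f 2 (volume.restrict Ω) := by
  cases k with
  | zero => exact h
  | succ k => exact h.1

theorem congr (h : MemW2 k Ω f) (hf : f =ᵐ[volume.restrict Ω] f') : MemW2 k Ω f' := by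
  cases k with
  | zero => exact (memLp_congr_ae hf).1 h
  | succ k =>
    refine ⟨(memLp_congr_ae hf).1 h.1, fun i => ?_⟩
    obtain ⟨g, hg, hgk⟩ := h.2 i
    exact ⟨g, hg.congr hf (EventuallyEq.refl _ _), hgk⟩

theorem mono (h : MemW2 k Ω f) (hU : U ⊆ Ω) : MemW2 k U f := by
  induction k generalizing f with
  | zero => exact h.memLp.mono_set hU
  | succ k ih =>
    refine ⟨h.memLp.mono_set hU, fun i => ?_⟩
    obtain ⟨g, hg, hgk⟩ := h.2 i
    exact ⟨g, hg.mono hU, ih hgk⟩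

theorem hasWeakPartialDeriv (hΩ : IsOpen Ω) (h : MemW2 (k + 1) Ω f) (i : Fin 2) :
    HasWeakPartialDeriv Ω i f (weakDeriv Ω i f) := by
  obtain ⟨g, hg, -⟩ := h.2 i
  exact hg.weakDeriv hΩ

theorem weakDeriv (hΩ : IsOpen Ω) (h : MemW2 (k + 1) Ω f) (i : Fin 2) :
    MemW2 k Ω (weakDeriv Ω i f) := by
  obtain ⟨g, hg, hgk⟩ := h.2 i
  exact hgk.congr (hg.ae_weakDeriv hΩ).symm

end MemW2

theorem weakDeriv_ae_eq_of_subset {Ω U : Set Plane} (hΩ : IsOpen Ω) (hU : IsOpen U) (hUΩ : U ⊆ Ω)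
    {k : ℕ} {f : Plane → ℝ} (hf : MemW2 (k + 1) Ω f) (i : Fin 2) :
    weakDeriv U i f =ᵐ[volume.restrict U] weakDeriv Ω i f :=
  ((hf.hasWeakPartialDeriv hΩ i).mono hUΩ).ae_weakDeriv hU

theorem weakDeriv_weakDeriv_ae_eq_of_subset {Ω U : Set Plane} (hΩ : IsOpen Ω) (hU : IsOpen U)
    (hUΩ : U ⊆ Ω) {k : ℕ} {f : Plane → ℝ} (hf : MemW2 (k + 2) Ω f) (i j : Fin 2) :
    weakDeriv U j (weakDeriv U i f) =ᵐ[volume.restrict U] weakDeriv Ω j (weakDeriv Ω i f) := by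
  have h : HasWeakPartialDeriv U j (weakDeriv Ω i f) (weakDeriv Ω j (weakDeriv Ω i f)) :=
    ((hf.weakDeriv hΩ i).hasWeakPartialDeriv hΩ j).mono hUΩ
  exact (h.congr (weakDeriv_ae_eq_of_subset hΩ hU hUΩ hf i).symm
    (EventuallyEq.refl _ _)).ae_weakDeriv hU

theorem flux_ae_eq_of_subset {Ω U : Set Plane} (hΩ : IsOpen Ω) (hU : IsOpen U) (hUΩ : U ⊆ Ω)
    {n : ℕ} {v : Plane → ℝ} (hv : MemW2 (n + 1) Ω v) (k : Fin 2) :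
    flux U v k =ᵐ[volume.restrict U] flux Ω v k := by
  filter_upwards [weakDeriv_ae_eq_of_subset hΩ hU hUΩ hv 0,
    weakDeriv_ae_eq_of_subset hΩ hU hUΩ hv 1,
    weakDeriv_ae_eq_of_subset hΩ hU hUΩ hv k] with x h0 h1 hk
  simp only [flux, Fin.sum_univ_two, h0, h1, hk]

theorem IsWeakSolution.mono {Ω U : Set Plane} (hΩ : IsOpen Ω) (hU : IsOpen U) (hUΩ : U ⊆ Ω)
    {v : Plane → ℝ} (hv : IsWeakSolution Ω v) : IsWeakSolution U v := by
  refine ⟨hv.1.mono hUΩ, fun φ hφ => ?_⟩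
  rw [← hv.2 φ (hφ.mono hUΩ)]
  rw [setIntegral_eq_of_subset_of_forall_sdiff_eq_zero hΩ.measurableSet hUΩ]
  · refine integral_congr_ae ?_
    filter_upwards [weakDeriv_weakDeriv_ae_eq_of_subset hΩ hU hUΩ hv.1 0 0,
      weakDeriv_weakDeriv_ae_eq_of_subset hΩ hU hUΩ hv.1 1 1,
      flux_ae_eq_of_subset hΩ hU hUΩ hv.1 0, flux_ae_eq_of_subset hΩ hU hUΩ hv.1 1]
      with x h0 h1 hf0 hf1
    simp only [Fin.sum_univ_two, h0, h1, hf0, hf1]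
  · intro x hx
    have e1 : ∀ k, partialDeriv k φ x = 0 := fun k => (hφ.partialDeriv k).eq_zero hx.2
    have e2 : ∀ k, partialDeriv k (partialDeriv k φ) x = 0 := fun k =>
      ((hφ.partialDeriv k).partialDeriv k).eq_zero hx.2
    simp [e1, e2]

/-- The weak equation with the integral split into its terms, which is legitimate as soon as the
flux is square integrable. -/
theorem IsWeakSolution.sum_integral_eq {Ω : Set Plane} (hΩ : IsOpen Ω) {v : Plane → ℝ}
    (hv : IsWeakSolution Ω v) (hF : ∀ k, MemLp (flux Ω v k) 2 (volume.restrict Ω))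
    {φ : Plane → ℝ} (hφ : IsTestFunction ⊤ Ω φ) :
    ∑ k, ∑ j, ∫ x, weakDeriv Ω j (weakDeriv Ω j v) x * partialDeriv k (partialDeriv k φ) x =
      ∑ k, ∫ x, flux Ω v k x * partialDeriv k φ x := by
  have hV : ∀ j, LocallyIntegrableOn (weakDeriv Ω j (weakDeriv Ω j v)) Ω := fun j =>
    ((hv.1.weakDeriv hΩ j).weakDeriv hΩ j).memLp.locallyIntegrableOn_restrict (by norm_num)
  have hFl : ∀ k, LocallyIntegrableOn (flux Ω v k) Ω := fun k =>
    (hF k).locallyIntegrableOn_restrict (by norm_num)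
  have I1 : ∀ k j, Integrable fun x =>
      weakDeriv Ω j (weakDeriv Ω j v) x * partialDeriv k (partialDeriv k φ) x := fun k j =>
    (hV j).integrable_mul_test ((hφ.partialDeriv k).partialDeriv k)
  have I2 : ∀ k, Integrable fun x => flux Ω v k x * partialDeriv k φ x := fun k =>
    (hFl k).integrable_mul_test (hφ.partialDeriv k)
  have h := hv.2 φ hφ
  rw [setIntegral_eq_integral_of_forall_compl_eq_zero] at h
  · have e : ∀ x, (∑ i, weakDeriv Ω i (weakDeriv Ω i v) x) *
        (∑ j, partialDeriv j (partialDeriv j φ) x) =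
        ∑ k, ∑ j, weakDeriv Ω j (weakDeriv Ω j v) x * partialDeriv k (partialDeriv k φ) x :=
      fun x => by rw [Finset.sum_mul_sum, Finset.sum_comm]
    simp only [e] at h
    rw [integral_sub (integrable_finsetSum _ fun k _ => integrable_finsetSum _ fun j _ => I1 k j)
      (integrable_finsetSum _ fun k _ => I2 k), integral_finsetSum _ fun k _ => I2 k,
      integral_finsetSum _ fun k _ => integrable_finsetSum _ fun j _ => I1 k j, sub_eq_zero] at h
    rw [← h]
    exact Finset.sum_congr rfl fun k _ => (integral_finsetSum _ fun j _ => I1 k j).symm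
  · intro x hx
    have e1 : ∀ k, partialDeriv k φ x = 0 := fun k => (hφ.partialDeriv k).eq_zero hx
    have e2 : ∀ k, partialDeriv k (partialDeriv k φ) x = 0 := fun k =>
      ((hφ.partialDeriv k).partialDeriv k).eq_zero hx
    simp [e1, e2]

/-! ### Regularity of the gradient and of the flux -/

theorem HasWeakPartialDeriv.integral_second {Ω : Set Plane} {i j : Fin 2} {f fi fij φ : Plane → ℝ}
    (hi : HasWeakPartialDeriv Ω i f fi) (hij : HasWeakPartialDeriv Ω j fi fij)
    (hφ : IsTestFunction ⊤ Ω φ) :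
    ∫ x, fij x * φ x = ∫ x, f x * partialDeriv i (partialDeriv j φ) x := by
  rw [hi.integral_eq (hφ.partialDeriv j), hij.integral_eq hφ, neg_neg]

/-- Moving all derivatives to the test function shows that the weak derivatives `v_{ij}` and
`v_{kk}` are exchangeable up to the corresponding exchange on the test function. -/
theorem integral_second_mul_laplacian_comm {Ω : Set Plane} {v : Plane → ℝ} {V : Fin 2 → Plane → ℝ}
    {V2 : Fin 2 → Fin 2 → Plane → ℝ} (hV : ∀ i, HasWeakPartialDeriv Ω i v (V i))
    (hV2 : ∀ i j, HasWeakPartialDeriv Ω j (V i) (V2 i j)) {φ : Plane → ℝ}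
    (hφ : IsTestFunction ⊤ Ω φ) (i j k : Fin 2) :
    ∫ x, V2 i j x * partialDeriv k (partialDeriv k φ) x =
      ∫ x, V2 k k x * partialDeriv j (partialDeriv i φ) x := by
  rw [(hV i).integral_second (hV2 i j) ((hφ.partialDeriv k).partialDeriv k),
    (hV k).integral_second (hV2 k k) ((hφ.partialDeriv i).partialDeriv j)]
  have hs := hφ.contDiff
  rw [partialDeriv_comm (hs.partialDeriv k) j k, partialDeriv_comm hs j k,
    partialDeriv_comm ((hs.partialDeriv j).partialDeriv k) i k,
    partialDeriv_comm (hs.partialDeriv j) i k, partialDeriv_comm hs j i]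

theorem hasWeakPartialDeriv_one_sub_sq {Ω : Set Plane} (hΩ : IsOpen Ω) {p : Fin 2}
    {V V' : Fin 2 → Plane → ℝ} (hV : ∀ i, MemLp (V i) 2 (volume.restrict Ω))
    (hV' : ∀ i, MemLp (V' i) 2 (volume.restrict Ω))
    (h : ∀ i, HasWeakPartialDeriv Ω p (V i) (V' i)) :
    HasWeakPartialDeriv Ω p (fun x => 1 - ∑ i, V i x ^ 2)
      (fun x => - (2 * (V 0 x * V' 0 x) + 2 * (V 1 x * V' 1 x))) := by
  have hs : ∀ i, HasWeakPartialDeriv Ω p _ _ := fun i =>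
    HasWeakPartialDeriv.mul hΩ (hV i) (hV' i) (hV i) (hV' i) (h i) (h i)
  have h1 := (HasWeakPartialDeriv.of_smooth (Ω := Ω) (contDiff_const (c := (1 : ℝ))) p).add
    ((hs 0).add (hs 1)).neg
  refine h1.congr (Eventually.of_forall fun x => ?_) (Eventually.of_forall fun x => ?_)
  · simp only [Fin.sum_univ_two]; ring
  · have : partialDeriv p (fun _ => (1 : ℝ)) x = 0 := by simp [partialDeriv]
    simp only [this]; ring

theorem holderTriple_six_six_three : ENNReal.HolderTriple 6 6 3 := by
  constructor
  rw [← ENNReal.toReal_eq_toReal_iff' (by simp) (by simp), ENNReal.toReal_add (by simp) (by simp)]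
  simp only [ENNReal.toReal_inv, ENNReal.toReal_ofNat]
  norm_num

theorem holderTriple_six_three_two : ENNReal.HolderTriple 6 3 2 := by
  constructor
  rw [← ENNReal.toReal_eq_toReal_iff' (by simp) (by simp), ENNReal.toReal_add (by simp) (by simp)]
  simp only [ENNReal.toReal_inv, ENNReal.toReal_ofNat]
  norm_num

section Six

variable {α : Type*} [MeasurableSpace α] {μ : Measure α}

/-- Hölder's inequality with exponents `1/6 + 1/6 + 1/6 = 1/2`. -/
theorem MeasureTheory.MemLp.mul_mul_of_six {a b c : α → ℝ} (ha : MemLp a 6 μ) (hb : MemLp b 6 μ)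
    (hc : MemLp c 6 μ) : MemLp (fun x => a x * (b x * c x)) 2 μ := by
  have := holderTriple_six_six_three
  have := holderTriple_six_three_two
  exact MemLp.mul' (p := 6) (q := 3) (MemLp.mul' (p := 6) (q := 6) (r := 3) hc hb) ha

/-- Covers both the flux (`a = V k`) and the part of its derivative in which `V k` is
differentiated. -/
theorem memLp_one_sub_sq_mul [IsFiniteMeasure μ] {V : Fin 2 → α → ℝ}
    (hV : ∀ i, MemLp (V i) 6 μ) {a : α → ℝ} (ha : MemLp a 6 μ) :
    MemLp (fun x => (1 - ∑ i, V i x ^ 2) * a x) 2 μ := by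
  have h1 := (ha.mono_exponent (p := 2) (by norm_num)).sub
    ((MemLp.mul_mul_of_six ha (hV 0) (hV 0)).add (MemLp.mul_mul_of_six ha (hV 1) (hV 1)))
  refine (memLp_congr_ae (Eventually.of_forall fun x => ?_)).1 h1
  simp only [Pi.sub_apply, Pi.add_apply, Fin.sum_univ_two]
  ring

end Six

theorem isFiniteMeasure_restrict_of_isCompact_closure {U : Set Plane} (hU : IsCompact (closure U)) :
    IsFiniteMeasure (volume.restrict U) :=
  ⟨by simpa using (measure_mono subset_closure).trans_lt hU.measure_lt_top⟩

/-- Interior regularity: the third weak derivatives exist and the flux is weakly differentiable,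
both in `L²`. -/
theorem IsWeakSolution.memW2_three {Ω U : Set Plane} (hΩ : IsOpen Ω) {v : Plane → ℝ}
    (hv : IsWeakSolution Ω v) (hU : IsOpen U) (hUc : IsCompact (closure U))
    (hUΩ : closure U ⊆ Ω) : MemW2 3 U v ∧ ∀ k, MemW2 1 U (flux U v k) := by
  obtain ⟨Ω₁, hΩ₁, hUΩ₁, hΩ₁Ω, hΩ₁c⟩ := exists_open_between_and_isCompact_closure hUc hΩ hUΩ
  obtain ⟨Ω₂, hΩ₂, hUΩ₂, hΩ₂Ω₁, hΩ₂c⟩ := exists_open_between_and_isCompact_closure hUc hΩ₁ hUΩ₁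
  obtain ⟨Ω₃, hΩ₃, hUΩ₃, hΩ₃Ω₂, hΩ₃c⟩ := exists_open_between_and_isCompact_closure hUc hΩ₂ hUΩ₂
  have s₁ : Ω₁ ⊆ Ω := subset_closure.trans hΩ₁Ω
  have s₂ : Ω₂ ⊆ Ω₁ := subset_closure.trans hΩ₂Ω₁
  have s₃ : Ω₃ ⊆ Ω₂ := subset_closure.trans hΩ₃Ω₂
  have s₄ : U ⊆ Ω₃ := subset_closure.trans hUΩ₃
  have hfin₁ := isFiniteMeasure_restrict_of_isCompact_closure hΩ₁c
  have hfin := isFiniteMeasure_restrict_of_isCompact_closure hUc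
  have hv₁ := hv.mono hΩ hΩ₁ s₁
  set V : Fin 2 → Plane → ℝ := fun i => weakDeriv Ω₁ i v with hVdef
  set V2 : Fin 2 → Fin 2 → Plane → ℝ := fun i j => weakDeriv Ω₁ j (V i) with hV2def
  have hV : ∀ i, HasWeakPartialDeriv Ω₁ i v (V i) := hv₁.1.hasWeakPartialDeriv hΩ₁
  have hVW : ∀ i, MemW2 1 Ω₁ (V i) := hv₁.1.weakDeriv hΩ₁
  have hV2 : ∀ i j, HasWeakPartialDeriv Ω₁ j (V i) (V2 i j) := fun i =>
    (hVW i).hasWeakPartialDeriv hΩ₁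
  have hV2L : ∀ i j, MemLp (V2 i j) 2 (volume.restrict Ω₁) := fun i j =>
    ((hVW i).weakDeriv hΩ₁ j).memLp
  -- By the Sobolev embedding on the larger set, the flux is square integrable on `Ω₁`.
  have hV6 : ∀ i, MemLp (V i) 6 (volume.restrict Ω₁) := fun i => by
    have hW := hv.1.weakDeriv hΩ i
    have h6 := memLp_six_of_hasWeakPartialDeriv hΩ hΩ₁c hΩ₁Ω hW.memLp
      (fun j => (hW.weakDeriv hΩ j).memLp) (hW.hasWeakPartialDeriv hΩ)
    exact (memLp_congr_ae (weakDeriv_ae_eq_of_subset hΩ hΩ₁ s₁ hv.1 i).symm).1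
      (h6.mono_set subset_closure)
  have hF : ∀ k, MemLp (flux Ω₁ v k) 2 (volume.restrict Ω₁) := fun k =>
    memLp_one_sub_sq_mul hV6 (hV6 k)
  -- The Laplacian solves a divergence form Poisson equation with the flux on the right-hand side.
  set h : Plane → ℝ := fun x => ∑ j, V2 j j x with hh
  have hhL : MemLp h 2 (volume.restrict Ω₁) := memLp_finsetSum _ fun j _ => hV2L j j
  have hsumh : ∀ {W : Set Plane} {ψ : Plane → ℝ}, W ⊆ Ω₁ → IsTestFunction ⊤ W ψ →
      ∫ x, h x * ψ x = ∑ j, ∫ x, V2 j j x * ψ x := fun hW hψ => by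
    simp only [hh, Finset.sum_mul]
    exact integral_finsetSum _ fun j _ =>
      ((hV2L j j).locallyIntegrableOn_restrict (by norm_num)).integrable_mul_test (hψ.mono hW)
  have hDh := exists_weakDeriv_of_laplacian_eq_div hΩ₁ hΩ₂ hΩ₂c hΩ₂Ω₁ hhL hF fun φ hφ => by
    rw [← hv₁.sum_integral_eq hΩ₁ hF hφ]
    exact Finset.sum_congr rfl fun k _ =>
      hsumh subset_rfl ((hφ.partialDeriv k).partialDeriv k)
  choose Dh hDhL hDh using hDh
  -- Each `v_{ij}` solves `Δ v_{ij} = ∂_i (Δv)_j`.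
  have hV3 : ∀ i j p, ∃ g, MemLp g 2 (volume.restrict Ω₃) ∧
      HasWeakPartialDeriv Ω₃ p (V2 i j) g := by
    intro i j p
    refine exists_weakDeriv_of_laplacian_eq_div hΩ₂ hΩ₃ hΩ₃c hΩ₃Ω₂ ((hV2L i j).mono_set s₂)
      (F := fun k => if k = i then fun x => - Dh j x else 0) (fun k => ?_) (fun φ hφ => ?_) p
    · by_cases hk : k = i
      · simp only [hk, if_true]; exact (hDhL j).neg
      · simp only [hk, if_false]; exact MemLp.zero
    · have e1 : ∀ k, ∫ x, V2 i j x * partialDeriv k (partialDeriv k φ) x =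
          ∫ x, V2 k k x * partialDeriv j (partialDeriv i φ) x := fun k =>
        integral_second_mul_laplacian_comm hV hV2 (hφ.mono s₂) i j k
      have e2 : ∑ k, ∫ x, (if k = i then fun x => - Dh j x else 0 : Plane → ℝ) x *
          partialDeriv k φ x = ∫ x, - Dh j x * partialDeriv i φ x := by
        rw [Finset.sum_eq_single i (fun k _ hk => by simp [hk]) (by simp)]
        simp
      rw [Finset.sum_congr rfl fun k _ => e1 k, e2,
        ← hsumh s₂ ((hφ.partialDeriv i).partialDeriv j),
        (hDh j).integral_eq (hφ.partialDeriv i)]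
      simp only [neg_mul, integral_neg]
  choose V3 hV3L hV3 using hV3
  have u₁ : U ⊆ Ω₁ := s₄.trans (s₃.trans s₂)
  refine ⟨⟨hv₁.1.memLp.mono_set u₁, fun i => ⟨V i, (hV i).mono u₁, (hVW i).memLp.mono_set u₁,
    fun j => ⟨V2 i j, (hV2 i j).mono u₁, (hV2L i j).mono_set u₁,
      fun p => ⟨V3 i j p, (hV3 i j p).mono s₄, (hV3L i j p).mono_set s₄⟩⟩⟩⟩, fun k => ?_⟩
  have hV26 : ∀ i j, MemLp (V2 i j) 6 (volume.restrict U) := fun i j =>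
    (memLp_six_of_hasWeakPartialDeriv hΩ₃ hUc hUΩ₃ ((hV2L i j).mono_set (s₃.trans s₂))
      (hV3L i j) (hV3 i j)).mono_set subset_closure
  have hV6U : ∀ i, MemLp (V i) 6 (volume.restrict U) := fun i => (hV6 i).mono_set u₁
  have to2 : ∀ {f : Plane → ℝ}, MemLp f 6 (volume.restrict U) → MemLp f 2 (volume.restrict U) :=
    fun hf => hf.mono_exponent (by norm_num)
  refine MemW2.congr (f := flux Ω₁ v k) ?_ (flux_ae_eq_of_subset hΩ₁ hU u₁ hv₁.1 k).symm
  refine ⟨(hF k).mono_set u₁, fun p => ?_⟩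
  have hw := hasWeakPartialDeriv_one_sub_sq hU (p := p) (fun i => to2 (hV6U i))
    (fun i => to2 (hV26 i p)) (fun i => (hV2 i p).mono u₁)
  have := holderTriple_six_six_three
  have hprod : ∀ i j, MemLp (fun x => V i x * V2 j p x) 2 (volume.restrict U) := fun i j =>
    (MemLp.mul' (p := 6) (q := 6) (r := 3) (hV26 j p) (hV6U i)).mono_exponent (by norm_num)
  have hwL : MemLp (fun x => 1 - ∑ i, V i x ^ 2) 2 (volume.restrict U) := by
    have := memLp_one_sub_sq_mul hV6U (memLp_const (1 : ℝ))
    simpa using this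
  have hwL' : MemLp (fun x => - (2 * (V 0 x * V2 0 p x) + 2 * (V 1 x * V2 1 p x))) 2
      (volume.restrict U) := (((hprod 0 0).const_mul 2).add ((hprod 1 1).const_mul 2)).neg
  refine ⟨_, hw.mul hU hwL hwL' (to2 (hV6U k)) (to2 (hV26 k p)) ((hV2 k p).mono u₁), ?_⟩
  have hA : ∀ i, MemLp (fun x => V k x * (V i x * V2 i p x)) 2 (volume.restrict U) := fun i =>
    MemLp.mul_mul_of_six (hV6U k) (hV6U i) (hV26 i p)
  have hB := memLp_one_sub_sq_mul hV6U (hV26 k p)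
  refine (memLp_congr_ae (Eventually.of_forall fun x => ?_)).1
    (((((hA 0).add (hA 1)).const_mul (-2))).add hB)
  simp only [Pi.add_apply]
  ring

/-! ### The differentiated equation -/

/-- The differentiated equation for smooth test functions: all derivatives are moved to `φ`, and the
weak equation is applied to `φ_{pp}`. -/
theorem sum_integral_third_eq {U : Set Plane} {v : Plane → ℝ} {V : Fin 2 → Plane → ℝ}
    {V2 : Fin 2 → Fin 2 → Plane → ℝ} {V3 : Fin 2 → Fin 2 → Fin 2 → Plane → ℝ}
    {F : Fin 2 → Plane → ℝ} {DF : Fin 2 → Fin 2 → Plane → ℝ}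
    (hV : ∀ i, HasWeakPartialDeriv U i v (V i))
    (hV2 : ∀ i j, HasWeakPartialDeriv U j (V i) (V2 i j))
    (hV3 : ∀ i j p, HasWeakPartialDeriv U p (V2 i j) (V3 i j p))
    (hF : ∀ k p, HasWeakPartialDeriv U p (F k) (DF k p))
    (heq : ∀ φ, IsTestFunction ⊤ U φ →
      ∑ k, ∑ j, ∫ x, V2 j j x * partialDeriv k (partialDeriv k φ) x =
        ∑ k, ∫ x, F k x * partialDeriv k φ x)
    {φ : Plane → ℝ} (hφ : IsTestFunction ⊤ U φ) :
    ∑ i, ∑ j, ∑ p, ∫ x in U, V3 i j p x * partialDeriv p (partialDeriv j (partialDeriv i φ)) x =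
      ∑ p, ∑ k, ∫ x in U, DF k p x * partialDeriv k (partialDeriv p φ) x := by
  have hs := hφ.contDiff
  have e1 : ∀ i j p,
      ∫ x in U, V3 i j p x * partialDeriv p (partialDeriv j (partialDeriv i φ)) x =
        - ∫ x, V2 j j x *
          partialDeriv i (partialDeriv i (partialDeriv p (partialDeriv p φ))) x := by
    intro i j p
    have ht := ((hφ.partialDeriv i).partialDeriv j).partialDeriv p
    have h1 := (hV3 i j p).integral_eq ht
    have h2 := (hV i).integral_second (hV2 i j) (ht.partialDeriv p)
    have h3 := (hV j).integral_second (hV2 j j)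
      ((((hφ.partialDeriv p).partialDeriv p).partialDeriv i).partialDeriv i)
    rw [setIntegral_mul_test ht]
    rw [h3]
    rw [show ∫ x, V3 i j p x * partialDeriv p (partialDeriv j (partialDeriv i φ)) x =
      - ∫ x, v x * partialDeriv i (partialDeriv j
        (partialDeriv p (partialDeriv p (partialDeriv j (partialDeriv i φ))))) x by linarith]
    -- Both sides are the same sixth order derivative of `φ`.
    have c : ∀ {f : Plane → ℝ}, ContDiff ℝ ∞ f → ∀ a b,
        partialDeriv a (partialDeriv b f) = partialDeriv b (partialDeriv a f) := fun hf a b =>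
      partialDeriv_comm hf a b
    have d : ∀ {f : Plane → ℝ}, ContDiff ℝ ∞ f → ∀ a, ContDiff ℝ ∞ (partialDeriv a f) :=
      fun hf a => hf.partialDeriv a
    have key : partialDeriv i (partialDeriv j
          (partialDeriv p (partialDeriv p (partialDeriv j (partialDeriv i φ))))) =
        partialDeriv j (partialDeriv j
          (partialDeriv i (partialDeriv i (partialDeriv p (partialDeriv p φ))))) := by
      rw [c (d hs i) p j, c hs p i, c (d (d hs p) i) p j, c (d hs p) p i,
        c (d (d (d (d hs p) p) i) j) i j, c (d (d (d hs p) p) i) i j]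
    rw [key]
  have e2 : ∀ p k, ∫ x in U, DF k p x * partialDeriv k (partialDeriv p φ) x =
      - ∫ x, F k x * partialDeriv k (partialDeriv p (partialDeriv p φ)) x := by
    intro p k
    have ht := (hφ.partialDeriv p).partialDeriv k
    rw [setIntegral_mul_test ht]
    have := (hF k p).integral_eq ht
    rw [partialDeriv_comm (hs.partialDeriv p) p k] at this
    linarith
  simp only [e1, e2, Finset.sum_neg_distrib]
  rw [neg_inj]
  have e3 : ∀ p, ∑ i, ∑ j, ∫ x, V2 j j x *
      partialDeriv i (partialDeriv i (partialDeriv p (partialDeriv p φ))) x =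
        ∑ k, ∫ x, F k x * partialDeriv k (partialDeriv p (partialDeriv p φ)) x := fun p =>
    heq _ ((hφ.partialDeriv p).partialDeriv p)
  rw [← Finset.sum_congr rfl fun p _ => e3 p, Finset.sum_comm]
  exact (Finset.sum_congr rfl fun _ _ => Finset.sum_comm).trans (by
    simp only [Fin.sum_univ_two]; ring)

/-! ### Approximation of compactly supported test functions -/

theorem tsupport_mollify_subset {U : Set Plane} {φ : Plane → ℝ} {n : ℕ} {δ : ℝ}
    (hn : (mollifierBump n).rOut ≤ δ) :
    tsupport (mollify U n φ) ⊆ Metric.cthickening δ (tsupport φ) := by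
  refine closure_minimal (fun x hx => ?_) Metric.isClosed_cthickening
  by_contra hxK
  have hz : ∀ y ∈ Metric.closedBall x δ, U.indicator φ y = 0 := fun y hy => by
    have h0 : φ y = 0 := image_eq_zero_of_notMem_tsupport fun hy' =>
      hxK (Metric.mem_cthickening_of_dist_le x y δ _ hy' (by simpa [dist_comm] using hy))
    simp [h0]
  have hx0 := hz x (by simpa using (mollifierBump n).rOut_pos.le.trans hn)
  refine hx ?_
  unfold mollify conv mollifier
  rw [(mollifierBump n).normed_convolution_eq_right, hx0]
  intro y hy
  rw [hx0, hz y (Metric.closedBall_subset_closedBall hn (Metric.ball_subset_closedBall hy))]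

/-- If `G` vanishes on `U` outside a closed set `K ⊆ W`, then truncating its mollifications to `W`
keeps the `L²(U)` convergence to `G`. -/
theorem tendsto_eLpNorm_sub_of_eq_mollify {U W K : Set Plane} (hU : IsOpen U) (hK : IsClosed K)
    (hKW : K ⊆ W) {G : Plane → ℝ} (hG : MemLp G 2 (volume.restrict U))
    (hG0 : G =ᵐ[volume.restrict (U \ K)] 0) {a : ℕ → Plane → ℝ}
    (ha : ∀ᶠ n in atTop, (∀ x ∈ W, a n x = mollify U n G x) ∧ ∀ x ∉ W, a n x = 0) :
    Tendsto (fun n => eLpNorm (a n - G) 2 (volume.restrict U)) atTop (𝓝 0) := by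
  refine tendsto_of_tendsto_of_tendsto_of_le_of_le' tendsto_const_nhds
    (tendsto_eLpNorm_mollify_sub hU hG) (Eventually.of_forall fun _ => zero_le) ?_
  filter_upwards [ha] with n hn
  refine eLpNorm_mono_ae ?_
  rw [EventuallyEq, ae_restrict_iff' (hU.sdiff hK).measurableSet] at hG0
  rw [ae_restrict_iff' hU.measurableSet]
  filter_upwards [hG0] with x hx hxU
  by_cases hxW : x ∈ W
  · simp [hn.1 x hxW]
  · simp [hn.2 x hxW, hx ⟨hxU, fun h => hxW (hKW h)⟩]

/-- A compactly supported `φ ∈ W^{3,2}(U)` is a limit of test functions whose second and third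
derivatives converge in `L²(U)` to those of `φ`. -/
theorem exists_isTestFunction_tendsto {U : Set Plane} (hU : IsOpen U) {φ : Plane → ℝ}
    (hc : HasCompactSupport φ) (hs : tsupport φ ⊆ U) (hφ : MemW2 3 U φ) :
    ∃ a : ℕ → Plane → ℝ, (∀ n, IsTestFunction ⊤ U (a n)) ∧
      (∀ i j, Tendsto (fun n => eLpNorm (partialDeriv j (partialDeriv i (a n)) -
        weakDeriv U j (weakDeriv U i φ)) 2 (volume.restrict U)) atTop (𝓝 0)) ∧
      ∀ i j p, Tendsto (fun n => eLpNorm (partialDeriv p (partialDeriv j (partialDeriv i (a n))) -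
        weakDeriv U p (weakDeriv U j (weakDeriv U i φ))) 2 (volume.restrict U)) atTop (𝓝 0) := by
  have hK : IsCompact (tsupport φ) := hc
  obtain ⟨W, hW, hKW, hWU, hWc⟩ := exists_open_between_and_isCompact_closure hK hU hs
  obtain ⟨δ, hδ, hδW⟩ := hK.exists_cthickening_subset_open hW hKW
  have hr := tendsto_mollifierBump_rOut.eventually (Iio_mem_nhds hδ)
  obtain ⟨N, hN⟩ := eventually_atTop.1
    (hr.and (eventually_isTestFunction_translate hU hWc hWU))
  have hL := hφ.memLp
  have h1 : ∀ i, MemW2 2 U (weakDeriv U i φ) := hφ.weakDeriv hU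
  have h2 : ∀ i j, MemW2 1 U (weakDeriv U j (weakDeriv U i φ)) := fun i => (h1 i).weakDeriv hU
  have h3 : ∀ i j p, MemW2 0 U (weakDeriv U p (weakDeriv U j (weakDeriv U i φ))) := fun i j =>
    (h2 i j).weakDeriv hU
  have d1 := fun i => hφ.hasWeakPartialDeriv hU i
  have d2 := fun i j => (h1 i).hasWeakPartialDeriv hU j
  have d3 := fun i j p => (h2 i j).hasWeakPartialDeriv hU p
  -- The weak derivatives of `φ` vanish outside the support of `φ`.
  have hO : IsOpen (U \ tsupport φ) := hU.sdiff (isClosed_tsupport φ)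
  have z0 : φ =ᵐ[volume.restrict (U \ tsupport φ)] 0 :=
    (ae_restrict_iff' hO.measurableSet).2
      (Eventually.of_forall fun x hx => image_eq_zero_of_notMem_tsupport hx.2)
  have z1 := fun i => ((d1 i).mono Set.sdiff_subset).ae_eq_zero hO z0
  have z2 := fun i j => ((d2 i j).mono Set.sdiff_subset).ae_eq_zero hO (z1 i)
  have z3 := fun i j p => ((d3 i j p).mono Set.sdiff_subset).ae_eq_zero hO (z2 i j)
  have ht : ∀ n ≥ N, tsupport (mollify U n φ) ⊆ W := fun n hn =>
    (tsupport_mollify_subset (le_of_lt (hN n hn).1)).trans hδW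
  have hTF : ∀ n ≥ N, IsTestFunction ⊤ U (mollify U n φ) := fun n hn =>
    ⟨contDiff_mollify hU hL n, HasCompactSupport.of_support_subset_isCompact hWc
      ((subset_tsupport _).trans ((ht n hn).trans subset_closure)),
      (ht n hn).trans (subset_closure.trans hWU)⟩
  -- Equality of functions on the open set `W` may be differentiated.
  have step : ∀ n ≥ N, ∀ {f g G : Plane → ℝ} {i : Fin 2}, MemLp G 2 (volume.restrict U) →
      HasWeakPartialDeriv U i G g → (∀ x ∈ W, f x = mollify U n G x) →
      ∀ x ∈ W, partialDeriv i f x = mollify U n g x := by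
    intro n hn f g G i hG hGg hf x hx
    have e : f =ᶠ[𝓝 x] mollify U n G := by
      filter_upwards [hW.mem_nhds hx] with y hy using hf y hy
    rw [← partialDeriv_mollify hU hG hGg ((hN n hn).2 x (subset_closure hx))]
    simp only [partialDeriv, e.fderiv_eq]
  have eq1 : ∀ n ≥ N, ∀ i, ∀ x ∈ W,
      partialDeriv i (mollify U n φ) x = mollify U n (weakDeriv U i φ) x := fun n hn i =>
    step n hn hL (d1 i) fun _ _ => rfl
  have eq2 : ∀ n ≥ N, ∀ i j, ∀ x ∈ W, partialDeriv j (partialDeriv i (mollify U n φ)) x =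
      mollify U n (weakDeriv U j (weakDeriv U i φ)) x := fun n hn i j =>
    step n hn (h1 i).memLp (d2 i j) (eq1 n hn i)
  have eq3 : ∀ n ≥ N, ∀ i j p, ∀ x ∈ W,
      partialDeriv p (partialDeriv j (partialDeriv i (mollify U n φ))) x =
        mollify U n (weakDeriv U p (weakDeriv U j (weakDeriv U i φ))) x := fun n hn i j p =>
    step n hn (h2 i j).memLp (d3 i j p) (eq2 n hn i j)
  have shift : ∀ {u : ℕ → ENNReal}, Tendsto u atTop (𝓝 0) →
      Tendsto (fun n => u (n + N)) atTop (𝓝 0) := fun hu => (tendsto_add_atTop_iff_nat N).2 hu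
  refine ⟨fun n => mollify U (n + N) φ, fun n => hTF _ (Nat.le_add_left N n), fun i j => ?_,
    fun i j p => ?_⟩
  · refine shift (u := fun n =>
      eLpNorm (partialDeriv j (partialDeriv i (mollify U n φ)) - _) _ _) ?_
    refine tendsto_eLpNorm_sub_of_eq_mollify hU (isClosed_tsupport φ) hKW (h2 i j).memLp (z2 i j) ?_
    filter_upwards [eventually_ge_atTop N] with n hn
    refine ⟨eq2 n hn i j, fun x hx => image_eq_zero_of_notMem_tsupport fun h => hx (ht n hn ?_)⟩
    exact tsupport_partialDeriv_subset i _ (tsupport_partialDeriv_subset j _ h)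
  · refine shift (u := fun n =>
      eLpNorm (partialDeriv p (partialDeriv j (partialDeriv i (mollify U n φ))) - _) _ _) ?_
    refine tendsto_eLpNorm_sub_of_eq_mollify hU (isClosed_tsupport φ) hKW (h3 i j p).memLp
      (z3 i j p) ?_
    filter_upwards [eventually_ge_atTop N] with n hn
    refine ⟨eq3 n hn i j p, fun x hx => image_eq_zero_of_notMem_tsupport fun h => hx (ht n hn ?_)⟩
    exact tsupport_partialDeriv_subset i _
      (tsupport_partialDeriv_subset j _ (tsupport_partialDeriv_subset p _ h))

theorem mainTheorem3 (Ω : Set Plane) (hΩ : IsOpen Ω) (v : Plane → ℝ)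
    (hv : IsWeakSolution Ω v) (U : Set Plane) (hU : IsOpen U)
    (hUc : IsCompact (closure U)) (hUΩ : closure U ⊆ Ω) :
    MemW2 3 U v ∧
      (∀ k : Fin 2, MemW2 1 U (flux U v k)) ∧
      ∀ φ : Plane → ℝ, IsTestFunction 1 U φ → MemW2 3 U φ →
        IntegrableOn (diffIntegrand U v φ) U ∧
          ∫ x in U, diffIntegrand U v φ x = 0 := by
  obtain ⟨hv3, hF⟩ := hv.memW2_three hΩ hU hUc hUΩ
  refine ⟨hv3, hF, fun φ hφ hφ3 => ?_⟩
  have hvU := hv.mono hΩ hU (subset_closure.trans hUΩ)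
  have hV1 := fun i => hv3.weakDeriv hU i
  have hV2 := fun i j => (hV1 i).weakDeriv hU j
  have hV3 := fun i j p => (hV2 i j).weakDeriv hU p
  have hΦ1 := fun i => hφ3.weakDeriv hU i
  have hΦ2 := fun i j => (hΦ1 i).weakDeriv hU j
  have hΦ3 := fun i j p => (hΦ2 i j).weakDeriv hU p
  have hDF := fun k p => (hF k).weakDeriv hU p
  have I1 : ∀ i j p, Integrable (fun x => weakDeriv U p (weakDeriv U j (weakDeriv U i v)) x *
      weakDeriv U p (weakDeriv U j (weakDeriv U i φ)) x) (volume.restrict U) := fun i j p =>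
    (hV3 i j p).memLp.integrable_mul (hΦ3 i j p).memLp
  have I2 : ∀ p k, Integrable (fun x => weakDeriv U p (flux U v k) x *
      weakDeriv U k (weakDeriv U p φ) x) (volume.restrict U) := fun p k =>
    (hDF k p).memLp.integrable_mul (hΦ2 p k).memLp
  have J1 := integrable_finsetSum Finset.univ fun i _ =>
    integrable_finsetSum Finset.univ fun j _ =>
      integrable_finsetSum Finset.univ fun p _ => I1 i j p
  have J2 := integrable_finsetSum Finset.univ fun p _ =>
    integrable_finsetSum Finset.univ fun k _ => I2 p k
  refine ⟨J1.sub J2, ?_⟩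
  obtain ⟨a, ha, ha2, ha3⟩ := exists_isTestFunction_tendsto hU hφ.2.1 hφ.2.2 hφ3
  have hid : ∀ n, _ = _ := fun n => sum_integral_third_eq
    (fun i => hv3.hasWeakPartialDeriv hU i) (fun i j => (hV1 i).hasWeakPartialDeriv hU j)
    (fun i j p => (hV2 i j).hasWeakPartialDeriv hU p) (fun k p => (hF k).hasWeakPartialDeriv hU p)
    (fun ψ hψ => hvU.sum_integral_eq hU (fun k => (hF k).memLp) hψ) (ha n)
  have T : ∀ {b : ℕ → Plane → ℝ} {c A : Plane → ℝ}, (∀ n, IsTestFunction ⊤ U (b n)) →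
      MemLp c 2 (volume.restrict U) → MemLp A 2 (volume.restrict U) →
      Tendsto (fun n => eLpNorm (b n - c) 2 (volume.restrict U)) atTop (𝓝 0) →
      Tendsto (fun n => ∫ x in U, A x * b n x) atTop (𝓝 (∫ x in U, A x * c x)) := by
    intro b c A hb hc hA h
    have := tendsto_integral_mul_of_tendsto_eLpNorm
      (Eventually.of_forall fun n => (hb n).memLp 2 U) hc hA h
    simpa only [mul_comm (A _)] using this
  have L1 := tendsto_finsetSum Finset.univ fun i (_ : i ∈ Finset.univ) =>
    tendsto_finsetSum Finset.univ fun j (_ : j ∈ Finset.univ) =>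
      tendsto_finsetSum Finset.univ fun p (_ : p ∈ Finset.univ) =>
        T (fun n => (((ha n).partialDeriv i).partialDeriv j).partialDeriv p)
          (hΦ3 i j p).memLp (hV3 i j p).memLp (ha3 i j p)
  have L2 := tendsto_finsetSum Finset.univ fun p (_ : p ∈ Finset.univ) =>
    tendsto_finsetSum Finset.univ fun k (_ : k ∈ Finset.univ) =>
      T (fun n => ((ha n).partialDeriv p).partialDeriv k)
        (hΦ2 p k).memLp (hDF k p).memLp (ha2 p k)
  have hlim := tendsto_nhds_unique L1 (L2.congr fun n => (hid n).symm)
  unfold diffIntegrand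
  rw [integral_sub J1 J2, sub_eq_zero]
  have S1 : ∫ x in U, ∑ i, ∑ j, ∑ p, weakDeriv U p (weakDeriv U j (weakDeriv U i v)) x *
      weakDeriv U p (weakDeriv U j (weakDeriv U i φ)) x =
      ∑ i, ∑ j, ∑ p, ∫ x in U, weakDeriv U p (weakDeriv U j (weakDeriv U i v)) x *
        weakDeriv U p (weakDeriv U j (weakDeriv U i φ)) x := by
    rw [integral_finsetSum _ fun i _ => integrable_finsetSum _ fun j _ =>
      integrable_finsetSum _ fun p _ => I1 i j p]
    refine Finset.sum_congr rfl fun i _ => ?_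
    rw [integral_finsetSum _ fun j _ => integrable_finsetSum _ fun p _ => I1 i j p]
    exact Finset.sum_congr rfl fun j _ => integral_finsetSum _ fun p _ => I1 i j p
  have S2 : ∫ x in U, ∑ p, ∑ k, weakDeriv U p (flux U v k) x * weakDeriv U k (weakDeriv U p φ) x =
      ∑ p, ∑ k, ∫ x in U, weakDeriv U p (flux U v k) x * weakDeriv U k (weakDeriv U p φ) x := by
    rw [integral_finsetSum _ fun p _ => integrable_finsetSum _ fun k _ => I2 p k]
    exact Finset.sum_congr rfl fun p _ => integral_finsetSum _ fun k _ => I2 p k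
  rw [S1, S2, hlim]
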